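/- Let $n\ge 1$, let $\Omega\subset\mathbb{R}^n$ be a bounded domain and let $c\in L^\infty(\Omega)$. Write $\mathcal{C}=\Omega\times(0,\infty)\subset\mathbb{R}^{n+1}$, with points $(x,y)$, and $\partial_L\mathcal{C}=\partial\Omega\times[0,\infty)$. By $C^2$ of the closure of an open set $U$ we mean the functions in $C^2(U)$ which, together with their derivatives of order at most two, extend continuously to $\overline U$. Let $\nu_0$ denote the unit outer normal in $\mathbb{R}^n$ to $\partial\Omega$ (where $\partial\Omega$ is smooth), and $\nu=(0,-1)$ the unit outer normal to $\mathcal{C}$ on $\Omega\times\{0\}$, so that $\frac{\partial v}{\partial\nu}=-\partial_y v(\cdot,0)$ there. For smooth $\Omega$, let $A_{1/2}$ be the square root of the Laplacian $-\Delta$ in $\Omega$ with zero Dirichlet boundary values, realized as follows: let $H^1_{0,L}(\mathcal{C})$ be the space of functions in $H^1(\mathcal{C})$ with zero trace on $\partial_L\mathcal{C}$ (equivalently, the closure in $H^1(\mathcal{C})$ of $C_c^\infty(\Omega\times\mathbb{R})$); for $g\in L^2(\Omega)$, $A_{1/2}u=g$ means that $u$ is the trace on $\Omega\times\{0\}$ of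 a function $v\in H^1_{0,L}(\mathcal{C})$ which satisfies $\int_{\mathcal{C}}\nabla v\cdot\nabla\xi\,dx\,dy=\int_\Omega g\,\xi(\cdot,0)\,dx$ for all $\xi\in H^1_{0,L}(\mathcal{C})$, that is, which solves weakly $\Delta v=0$ in $\mathcal{C}$, $v=0$ on $\partial_L\mathcal{C}$, $\frac{\partial v}{\partial\nu}=g$ on $\Omega\times\{0\}$. (i) Assume that $\Omega$ is smooth and that $u\in C^2(\overline\Omega)$, $u\not\equiv 0$, satisfies $$A_{1/2}u+c(x)u\ge 0\ \text{ a.e. in }\Omega,\qquad u\ge 0\ \text{ in }\Omega,\qquad u=0\ \text{ on }\partial\Omega.$$ Then $\frac{\partial u}{\partial\nu_0}<0$ on $\partial\Omega$. (ii) Let $P\in\partial\Omega$ and assume that $\partial\Omega$ is smooth in a neighborhood of $P$ ($\Omega$ not necessarily smooth elsewhere). Let $v\in C^2(\overline{\mathcal{C}})\cap L^\infty(\mathcal{C})$, $v\not\equiv 0$, satisfy $$\Delta v=0\ \text{ in }\mathcal{C},\qquad v\ge 0\ \text{ on }\partial_L\mathcal{C}\text{ and on }\Omega\times\{0\},\qquad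 \frac{\partial v}{\partial\nu}+c(x)v\ge 0\ \text{ a.e. on }\Omega\times\{0\}.$$ If $v(P,0)=0$, then $\frac{\partial v}{\partial\nu_0}(P,0)<0$. -/

import Mathlib

open MeasureTheory Filter Topology
open scoped ContDiff ENNReal Gradient

/-- The space `ℝⁿ × ℝ` with its Euclidean structure; its points are written `(x, y)`. -/
abbrev HalfCyl.Space (n : ℕ) : Type := WithLp 2 (EuclideanSpace ℝ (Fin n) × ℝ)

namespace HalfCyl

/-- The point `(x, y)` of `ℝⁿ × ℝ`. -/
def pt {n : ℕ} (x : EuclideanSpace ℝ (Fin n)) (y : ℝ) : Space n := WithLp.toLp 2 (x, y)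

/-- The half-cylinder `𝒞 = Ω × (0, ∞)`. -/
def cylinder {n : ℕ} (Ω : Set (EuclideanSpace ℝ (Fin n))) : Set (Space n) :=
  {z | z.fst ∈ Ω ∧ 0 < z.snd}

/-- `f ∈ C²(closure U)` for an open set `U`: `f` is `C²` in `U`, and `f` together with its first
and second derivatives extends continuously to the closure of `U` (the values of `f` on the
closure being those of the extension). -/
structure IsC2Closure {F : Type*} [NormedAddCommGroup F] [NormedSpace ℝ F]
    (U : Set F) (f : F → ℝ) : Prop where
  contDiffOn : ContDiffOn ℝ 2 f U
  continuousOn : ContinuousOn f (closure U)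
  fderiv_extends : ∃ D : F → F →L[ℝ] ℝ, ContinuousOn D (closure U) ∧ Set.EqOn D (fderiv ℝ f) U
  fderiv_fderiv_extends : ∃ D : F → F →L[ℝ] F →L[ℝ] ℝ,
    ContinuousOn D (closure U) ∧ Set.EqOn D (fderiv ℝ (fderiv ℝ f)) U

/-- Near `p`, the set `Ω` is the sublevel set `{ρ < 0}` of a `C^∞` function `ρ` with nonvanishing
gradient at `p`. -/
def IsLocalDefiningFunction {n : ℕ} (Ω : Set (EuclideanSpace ℝ (Fin n)))
    (p : EuclideanSpace ℝ (Fin n)) (ρ : EuclideanSpace ℝ (Fin n) → ℝ) : Prop :=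
  ∃ U : Set (EuclideanSpace ℝ (Fin n)), IsOpen U ∧ p ∈ U ∧ ContDiffOn ℝ ∞ ρ U ∧
    ∇ ρ p ≠ 0 ∧ ∀ x ∈ U, (x ∈ Ω ↔ ρ x < 0)

/-- The boundary of `Ω` is smooth in a neighbourhood of its point `p`. -/
def SmoothBoundaryAt {n : ℕ} (Ω : Set (EuclideanSpace ℝ (Fin n)))
    (p : EuclideanSpace ℝ (Fin n)) : Prop :=
  ∃ ρ, IsLocalDefiningFunction Ω p ρ

/-- `Ω` has smooth boundary. -/
def SmoothBoundary {n : ℕ} (Ω : Set (EuclideanSpace ℝ (Fin n))) : Prop :=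
  ∀ p ∈ frontier Ω, SmoothBoundaryAt Ω p

/-- `ν` is the unit outer normal to `∂Ω` at the boundary point `p`: the normalized gradient of a
local defining function. -/
def IsUnitOuterNormal {n : ℕ} (Ω : Set (EuclideanSpace ℝ (Fin n)))
    (p ν : EuclideanSpace ℝ (Fin n)) : Prop :=
  ∃ ρ, IsLocalDefiningFunction Ω p ρ ∧ ν = ‖∇ ρ p‖⁻¹ • ∇ ρ p

/-- The outer normal derivative of `f` at a boundary point `p` with outer normal `ν`: the
derivative at `t = 0` of `t ↦ f (p + t ν)`, taken from the inner side `t ≤ 0`. -/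
noncomputable def normalDeriv {F : Type*} [AddCommGroup F] [Module ℝ F]
    (f : F → ℝ) (p ν : F) : ℝ :=
  derivWithin (fun t : ℝ => f (p + t • ν)) (Set.Iic 0) 0

/-- Smooth functions with compact support in `Ω × ℝ`. They vanish near the lateral boundary of the
half-cylinder, but not necessarily on its base `Ω × {0}`. -/
structure IsTestFunction {n : ℕ} (Ω : Set (EuclideanSpace ℝ (Fin n)))
    (ξ : Space n → ℝ) : Prop where
  contDiff : ContDiff ℝ ∞ ξ
  hasCompactSupport : HasCompactSupport ξ
  tsupport_subset : tsupport ξ ⊆ {z | z.fst ∈ Ω}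

/-- `v` is an `H¹` function on the half-cylinder with zero trace on the lateral boundary, with
gradient `G` and with trace `u` on the base. The space of such functions is the `H¹`-closure of
the test functions; gradient and trace on the base are the `L²`-limits of the classical ones. -/
def IsH1ZeroLateral {n : ℕ} (Ω : Set (EuclideanSpace ℝ (Fin n)))
    (v : Space n → ℝ) (G : Space n → Space n) (u : EuclideanSpace ℝ (Fin n) → ℝ) : Prop :=
  MemLp v 2 (volume.restrict (cylinder Ω)) ∧ MemLp G 2 (volume.restrict (cylinder Ω)) ∧
  MemLp u 2 (volume.restrict Ω) ∧
  ∃ ξ : ℕ → Space n → ℝ, (∀ k, IsTestFunction Ω (ξ k)) ∧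
    Tendsto (fun k => eLpNorm (fun z => ξ k z - v z) 2 (volume.restrict (cylinder Ω)))
      atTop (𝓝 0) ∧
    Tendsto (fun k => eLpNorm (fun z => ∇ (ξ k) z - G z) 2 (volume.restrict (cylinder Ω)))
      atTop (𝓝 0) ∧
    Tendsto (fun k => eLpNorm (fun x => ξ k (pt x 0) - u x) 2 (volume.restrict Ω))
      atTop (𝓝 0)

/-- `A_{1/2} u = g` with `g ∈ L²(Ω)`, where `A_{1/2}` is the square root of the Dirichlet
Laplacian in `Ω`, realized as the Dirichlet-to-Neumann map of the half-cylinder: `u` is the trace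
of an `H¹` function `v` with zero lateral trace which is a weak solution of `Δ v = 0` in the
half-cylinder with `∂v/∂ν = g` on the base. -/
def IsSqrtDirichletLaplacian {n : ℕ} (Ω : Set (EuclideanSpace ℝ (Fin n)))
    (u g : EuclideanSpace ℝ (Fin n) → ℝ) : Prop :=
  MemLp g 2 (volume.restrict Ω) ∧
  ∃ (v : Space n → ℝ) (G : Space n → Space n), IsH1ZeroLateral Ω v G u ∧
    ∀ ξ : Space n → ℝ, IsTestFunction Ω ξ →
      ∫ z in cylinder Ω, inner ℝ (G z) (∇ ξ z) = ∫ x in Ω, g x * ξ (pt x 0)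

end HalfCyl

/-! Both parts are Hopf boundary lemmas at the edge point (P, 0), where the lateral boundary meets
the base. The barrier is b = (exp(-l|z - z₀|²) - exp(-lρ²)) exp(My), where M is a bound for |c|. For
large l it is strictly subharmonic in an annulus about z₀. The factor exp(My) takes care of the
Robin condition: if z₀ does not lie below the base, then ∂_y b ≥ M b at base points, whereas the
solution satisfies the opposite inequality ∂_y v ≤ M v there, because c ≤ M and v ≥ 0. So εb lies
below v in the half-ball about z₀ as soon as v has a positive lower bound on a small inner ball.
With z₀ = (P - Rν, 0), the centre of an interior tangent ball, this bounds the solution below along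
the normal segment in the base by a function that vanishes at P with negative slope.

The inner lower bound comes from a quantitative strong maximum principle using the same barrier: a
bound near z₀ spreads to any smaller concentric ball inside a ball contained in Ω × ℝ. Connectedness
of the cylinder carries it everywhere, and balls that cross the base carry it down to y = 0
(`exists_low_of_chain`).

In (ii) comparison is the pointwise argument at a minimum (`barrier_le_of_harmonic`), and v ≥ 0
comes from a Phragmén–Lindelöf argument (`nonneg_of_harmonic_of_bounded`).

In (i) only the H¹ extension v of u is available, and no regularity of v is used. Comparison is done
in energy form (`ae_le_of_weak_solution`): the weak equation is tested with β(w - ξₖ), where ξₖ are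
the test functions approximating v and β is a smooth substitute for the positive part. Lower bounds
for v hold almost everywhere; on the base they become pointwise because u is continuous. Positivity
starts from a point where u > 0, through a barrier centred below the base. -/

namespace HalfCyl

/-! ### The Gaussian barrier, its derivative and its Laplacian -/

section Laplacian

variable {E : Type*} [NormedAddCommGroup E] [InnerProductSpace ℝ E]

open InnerProductSpace

/-- The exponent of the barrier functions. -/
noncomputable def gaussExponent (l : ℝ) (z₀ a z : E) : ℝ := -l * ‖z - z₀‖ ^ 2 + inner ℝ a z

theorem contDiff_gaussExponent (l : ℝ) (z₀ a : E) {m : ℕ∞ω} :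
    ContDiff ℝ m (gaussExponent l z₀ a) := by
  unfold gaussExponent
  have h1 : ContDiff ℝ m fun z : E => ‖z - z₀‖ ^ 2 := (contDiff_id.sub contDiff_const).norm_sq ℝ
  have h2 : ContDiff ℝ m fun z : E => inner ℝ a z := contDiff_const.inner ℝ contDiff_id
  exact (contDiff_const.mul h1).add h2

theorem hasFDerivAt_gaussExponent (l : ℝ) (z₀ a z : E) :
    HasFDerivAt (gaussExponent l z₀ a) (innerSL ℝ (-(2 * l) • (z - z₀) + a)) z := by
  unfold gaussExponent
  have h1 : HasFDerivAt (fun z : E => ‖z - z₀‖ ^ 2) (2 • innerSL ℝ (z - z₀)) z := by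
    simpa using ((hasFDerivAt_id z).sub_const z₀).norm_sq
  have h2 : HasFDerivAt (fun z : E => inner ℝ a z) (innerSL ℝ a) z := (innerSL ℝ a).hasFDerivAt
  refine ((h1.const_mul (-l)).add h2).congr_fderiv ?_
  ext e
  simp
  ring

theorem fderiv_exp_gaussExponent (l : ℝ) (z₀ a z e : E) :
    fderiv ℝ (fun z => Real.exp (gaussExponent l z₀ a z)) z e
      = Real.exp (gaussExponent l z₀ a z) * inner ℝ (-(2 * l) • (z - z₀) + a) e := by
  rw [(hasFDerivAt_gaussExponent l z₀ a z).exp.fderiv]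
  rfl

/-- The barrier `(exp (-l |z - z₀|²) - exp (-l ρ²)) exp ⟨a, z⟩`, positive in the ball of
radius `ρ` about `z₀`. -/
noncomputable def barrier (l ρ : ℝ) (z₀ a z : E) : ℝ :=
  Real.exp (gaussExponent l z₀ a z) - Real.exp (-l * ρ ^ 2) * Real.exp (gaussExponent 0 z₀ a z)

/-- The difference of two exponentials is the form to differentiate; the product shows sign and
size. -/
theorem barrier_eq (l ρ : ℝ) (z₀ a z : E) : barrier l ρ z₀ a z
    = (Real.exp (-l * ‖z - z₀‖ ^ 2) - Real.exp (-l * ρ ^ 2)) * Real.exp (inner ℝ a z) := by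
  simp only [barrier, gaussExponent, Real.exp_add]
  simp
  ring

theorem contDiff_barrier (l ρ : ℝ) (z₀ a : E) {m : ℕ∞ω} : ContDiff ℝ m (barrier l ρ z₀ a) :=
  (contDiff_gaussExponent l z₀ a).exp.sub
    (contDiff_const.mul (contDiff_gaussExponent 0 z₀ a).exp)

theorem barrier_nonpos {l ρ : ℝ} (hl : 0 < l) (hρ : 0 ≤ ρ) {z₀ z : E} (a : E)
    (hz : ρ ≤ ‖z - z₀‖) : barrier l ρ z₀ a z ≤ 0 := by
  rw [barrier_eq]
  refine mul_nonpos_of_nonpos_of_nonneg (sub_nonpos.2 (Real.exp_le_exp.2 ?_)) (Real.exp_pos _).le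
  nlinarith [pow_le_pow_left₀ hρ hz 2]

/-- On the ball of radius `ρ ≤ R` the barrier is bounded independently of `ρ`. -/
theorem barrier_le {l ρ R : ℝ} (hl : 0 < l) {z₀ z : E} (a : E) (hz : ‖z - z₀‖ ≤ R) :
    barrier l ρ z₀ a z ≤ Real.exp (‖a‖ * (‖z₀‖ + R)) := by
  rw [barrier_eq]
  have h1 : Real.exp (-l * ‖z - z₀‖ ^ 2) ≤ 1 :=
    Real.exp_le_one_iff.2 (by nlinarith [sq_nonneg ‖z - z₀‖])
  have h2 : inner ℝ a z ≤ ‖a‖ * (‖z₀‖ + R) := by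
    refine (real_inner_le_norm a z).trans (mul_le_mul_of_nonneg_left ?_ (norm_nonneg a))
    have := norm_add_le z₀ (z - z₀)
    rw [add_sub_cancel] at this
    linarith
  calc _ ≤ 1 * Real.exp (inner ℝ a z) := by
        gcongr
        linarith [Real.exp_pos (-l * ρ ^ 2)]
    _ ≤ _ := by rw [one_mul]; exact Real.exp_le_exp.2 h2

/-- For `a = M • vert n`, `e = vert n` and z on the base, the last term becomes +2l·z₀.snd·exp(…).
Hence ∂_y b ≥ M b there when l ≥ 0 and the centre is not below the base. -/
theorem fderiv_barrier (l ρ : ℝ) (z₀ a z e : E) : fderiv ℝ (barrier l ρ z₀ a) z e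
    = barrier l ρ z₀ a z * inner ℝ a e
      - 2 * l * Real.exp (gaussExponent l z₀ a z) * inner ℝ (z - z₀) e := by
  have h1 := (hasFDerivAt_gaussExponent l z₀ a z).exp
  have h2 := ((hasFDerivAt_gaussExponent 0 z₀ a z).exp).const_mul (Real.exp (-l * ρ ^ 2))
  have h3 : HasFDerivAt (barrier l ρ z₀ a) _ z := h1.sub h2
  rw [h3.fderiv]
  simp only [sub_apply, smul_apply, innerSL_apply_apply,
    smul_eq_mul, barrier, inner_add_left, real_inner_smul_left]
  ring

variable [FiniteDimensional ℝ E]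

/-- The Laplacian as the sum of the iterated directional derivatives along an orthonormal basis. -/
theorem laplacian_eq_sum_fderiv {ι : Type*} [Fintype ι] (b : OrthonormalBasis ι ℝ E) {f : E → ℝ}
    {z : E} (hf : ContDiffAt ℝ 2 f z) :
    Laplacian.laplacian f z = ∑ i, fderiv ℝ (fun y => fderiv ℝ f y (b i)) z (b i) := by
  rw [laplacian_eq_iteratedFDeriv_orthonormalBasis f b]
  refine Finset.sum_congr rfl fun i _ => ?_
  have hd : DifferentiableAt ℝ (fderiv ℝ f) z :=
    (hf.fderiv_right (m := 1) (by norm_num)).differentiableAt (by norm_num)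
  rw [iteratedFDeriv_two_apply, fderiv_clm_apply hd (differentiableAt_const _)]
  simp

/-- The Laplacian is nonnegative at a local minimum. -/
theorem laplacian_nonneg_of_isLocalMin {f : E → ℝ} {z : E} (hf : ContDiffAt ℝ 2 f z)
    (hmin : IsLocalMin f z) : 0 ≤ Laplacian.laplacian f z := by
  rw [laplacian_eq_sum_fderiv (stdOrthonormalBasis ℝ E) hf]
  refine Finset.sum_nonneg fun i _ => ?_
  set e := stdOrthonormalBasis ℝ E i
  -- A negative second derivative along `e` would make the minimum also a local maximum along that
  -- line. The restriction would then be locally constant, with second derivative zero.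
  by_contra! hneg
  have hline : HasDerivAt (fun t : ℝ => z + t • e) e 0 := by
    simpa using ((hasDerivAt_id (0 : ℝ)).smul_const e).const_add z
  have hline' : ∀ t : ℝ, HasDerivAt (fun t : ℝ => z + t • e) e t := fun t => by
    simpa using ((hasDerivAt_id t).smul_const e).const_add z
  have hcont : Tendsto (fun t : ℝ => z + t • e) (𝓝 0) (𝓝 z) := by
    simpa using hline.continuousAt.tendsto
  have hdiff : ∀ᶠ t : ℝ in 𝓝 0, DifferentiableAt ℝ f (z + t • e) :=
    hcont.eventually ((hf.eventually (by simp)).mono fun y hy => hy.differentiableAt (by norm_num))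
  have hd1 : ∀ᶠ t : ℝ in 𝓝 0, deriv (fun t : ℝ => f (z + t • e)) t = fderiv ℝ f (z + t • e) e :=
    hdiff.mono fun t ht => (ht.hasFDerivAt.comp_hasDerivAt t (hline' t)).deriv
  have hd : DifferentiableAt ℝ (fun y => fderiv ℝ f y e) z :=
    ((hf.fderiv_right (m := 1) (by norm_num)).differentiableAt (by norm_num)).clm_apply
      (differentiableAt_const _)
  have hd2 : deriv (deriv fun t : ℝ => f (z + t • e)) 0
      = fderiv ℝ (fun y => fderiv ℝ f y e) z e := by
    rw [Filter.EventuallyEq.deriv_eq hd1]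
    have : HasFDerivAt (fun y => fderiv ℝ f y e) (fderiv ℝ (fun y => fderiv ℝ f y e) z)
      (z + (0 : ℝ) • e) := by simpa using hd.hasFDerivAt
    exact (this.comp_hasDerivAt (0 : ℝ) hline).deriv
  have hmin' : IsLocalMin (fun t : ℝ => f (z + t • e)) 0 := by
    have := hcont.eventually hmin
    simpa [IsLocalMin, IsMinFilter] using this
  have hfz : ContinuousAt (fun t : ℝ => f (z + t • e)) 0 := by
    have : ContinuousAt f (z + (0 : ℝ) • e) := by simpa using hf.continuousAt
    exact ContinuousAt.comp (f := fun t : ℝ => z + t • e) this hline.continuousAt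
  have hmax : IsLocalMax (fun t : ℝ => f (z + t • e)) 0 :=
    isLocalMax_of_deriv_deriv_neg (by rw [hd2]; exact hneg) hmin'.deriv_eq_zero hfz
  have hconst : (fun t : ℝ => f (z + t • e)) =ᶠ[𝓝 0] fun _ => f (z + (0 : ℝ) • e) := by
    filter_upwards [hmin', hmax] with t h1 h2 using le_antisymm h2 h1
  have : deriv (deriv fun t : ℝ => f (z + t • e)) 0 = 0 := by
    rw [hconst.deriv.deriv_eq]; simp
  rw [hd2] at this
  exact hneg.ne this

/-- This is Δ(exp φ) = exp φ · (|∇φ|² + Δφ), where Δφ = -2l · dim E. -/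
theorem laplacian_exp_gaussExponent (l : ℝ) (z₀ a z : E) :
    Laplacian.laplacian (fun z => Real.exp (gaussExponent l z₀ a z)) z
      = Real.exp (gaussExponent l z₀ a z) *
        (‖-(2 * l) • (z - z₀) + a‖ ^ 2 - 2 * l * Module.finrank ℝ E) := by
  set b := stdOrthonormalBasis ℝ E
  rw [laplacian_eq_sum_fderiv b (contDiff_gaussExponent l z₀ a).exp.contDiffAt]
  simp only [fderiv_exp_gaussExponent]
  have hstep : ∀ e : E, ‖e‖ = 1 → fderiv ℝ (fun y => Real.exp (gaussExponent l z₀ a y) *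
        inner ℝ (-(2 * l) • (y - z₀) + a) e) z e
      = Real.exp (gaussExponent l z₀ a z) * (inner ℝ (-(2 * l) • (z - z₀) + a) e) ^ 2
        - Real.exp (gaussExponent l z₀ a z) * (2 * l) := by
    intro e he
    have h1 := (hasFDerivAt_gaussExponent l z₀ a z).exp
    have h2 : HasFDerivAt (fun y : E => inner ℝ (-(2 * l) • (y - z₀) + a) e)
        (-(2 * l) • innerSL ℝ e) z := by
      have h3 : HasFDerivAt (fun y : E => -(2 * l) • (y - z₀) + a)
          (-(2 * l) • ContinuousLinearMap.id ℝ E) z :=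
        (((hasFDerivAt_id z).sub_const z₀).const_smul (-(2 * l))).add_const a
      refine (h3.inner ℝ (hasFDerivAt_const e z)).congr_fderiv ?_
      ext w
      simp [inner_smul_left, real_inner_comm]
    rw [(h1.fun_mul h2).fderiv]
    simp only [add_apply, smul_apply, innerSL_apply_apply,
      smul_eq_mul, real_inner_self_eq_norm_sq, he]
    ring
  rw [Finset.sum_congr rfl fun i _ => hstep (b i) (b.norm_eq_one i), Finset.sum_sub_distrib,
    ← Finset.mul_sum]
  have : ∑ i, (inner ℝ (-(2 * l) • (z - z₀) + a) (b i)) ^ 2 = ‖-(2 * l) • (z - z₀) + a‖ ^ 2 := by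
    rw [← b.sum_sq_norm_inner_left]
    simp [Real.norm_eq_abs]
  rw [this]
  simp
  ring

/-- The barrier is strictly subharmonic in an annulus, for `l` large. -/
theorem laplacian_barrier_pos {l ρ r R : ℝ} (hr : 0 < r) {z₀ z a : E}
    (hl : 2 * R * ‖a‖ + Module.finrank ℝ E < 2 * l * r ^ 2) (h1 : r ≤ ‖z - z₀‖)
    (h2 : ‖z - z₀‖ ≤ ρ) (h3 : ρ ≤ R) : 0 < Laplacian.laplacian (barrier l ρ z₀ a) z := by
  have hl0 : 0 < l := by
    have : 0 < 2 * l * r ^ 2 := by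
      have : 0 ≤ 2 * R * ‖a‖ := by
        have : 0 ≤ R := by linarith
        positivity
      have : (0 : ℝ) ≤ Module.finrank ℝ E := by positivity
      linarith
    by_contra! h
    nlinarith [sq_nonneg r]
  have hsub : barrier l ρ z₀ a = (fun z => Real.exp (gaussExponent l z₀ a z))
      - (Real.exp (-l * ρ ^ 2)) • fun z => Real.exp (gaussExponent 0 z₀ a z) := rfl
  have hC : ContDiffAt ℝ 2 (Real.exp (-l * ρ ^ 2) • fun z => Real.exp (gaussExponent 0 z₀ a z)) z :=
    contDiffAt_const.smul (contDiff_gaussExponent 0 z₀ a).exp.contDiffAt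
  rw [hsub, ContDiffAt.laplacian_sub (contDiff_gaussExponent l z₀ a).exp.contDiffAt hC,
    laplacian_smul _ (contDiff_gaussExponent 0 z₀ a).exp.contDiffAt,
    laplacian_exp_gaussExponent, laplacian_exp_gaussExponent]
  set s := ‖z - z₀‖
  have hs : 0 < s := hr.trans_le h1
  have hexp : Real.exp (-l * ρ ^ 2) ≤ Real.exp (-l * s ^ 2) :=
    Real.exp_le_exp.2 (by nlinarith [pow_le_pow_left₀ hs.le h2 2])
  have hnorm : 4 * l ^ 2 * s ^ 2 - 4 * l * s * ‖a‖ + ‖a‖ ^ 2 ≤ ‖-(2 * l) • (z - z₀) + a‖ ^ 2 := by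
    rw [norm_add_sq_real, norm_smul, inner_smul_left]
    have := real_inner_le_norm (z - z₀) a
    simp only [norm_neg, norm_mul, Real.norm_eq_abs, abs_of_pos hl0]
    simp
    nlinarith
  -- By `hnorm` it suffices that 2s‖a‖ + dim E < 2ls², which is `hl` together with r ≤ s ≤ R.
  have hmain : ‖a‖ ^ 2 < ‖-(2 * l) • (z - z₀) + a‖ ^ 2 - 2 * l * Module.finrank ℝ E := by
    have h5 : 2 * s * ‖a‖ ≤ 2 * R * ‖a‖ := by gcongr; linarith
    have h6 : 2 * l * r ^ 2 ≤ 2 * l * s ^ 2 := by gcongr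
    nlinarith
  have e1 : Real.exp (gaussExponent l z₀ a z) = Real.exp (-l * s ^ 2) * Real.exp (inner ℝ a z) := by
    rw [gaussExponent, Real.exp_add]
  have e2 : Real.exp (gaussExponent 0 z₀ a z) = Real.exp (inner ℝ a z) := by
    simp [gaussExponent]
  rw [e1, e2]
  simp only [smul_eq_mul, mul_zero, neg_zero, zero_smul, zero_add, zero_mul, sub_zero]
  have hp := Real.exp_pos (inner ℝ a z)
  have hq := Real.exp_pos (-l * s ^ 2)
  have : Real.exp (-l * ρ ^ 2) * (Real.exp (inner ℝ a z) * ‖a‖ ^ 2)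
      ≤ Real.exp (-l * s ^ 2) * (Real.exp (inner ℝ a z) * ‖a‖ ^ 2) := by gcongr
  have := mul_lt_mul_of_pos_left hmain (mul_pos hq hp)
  linarith

end Laplacian

end HalfCyl

namespace HalfCyl

/-! ### The half-cylinder and the interior tangent ball -/

section Geometry

variable {n : ℕ}

/-- A shortcut, to spare a slow instance search. -/
instance continuousSMul_space : @ContinuousSMul ℝ (Space n) _ _
    PseudoMetricSpace.toUniformSpace.toTopologicalSpace :=
  IsBoundedSMul.continuousSMul

@[simp] theorem pt_fst (x : EuclideanSpace ℝ (Fin n)) (y : ℝ) : (pt x y).fst = x := rfl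

@[simp] theorem pt_snd (x : EuclideanSpace ℝ (Fin n)) (y : ℝ) : (pt x y).snd = y := rfl

theorem pt_eta (z : Space n) : pt z.fst z.snd = z := rfl

theorem pt_add (x x' : EuclideanSpace ℝ (Fin n)) (y y' : ℝ) :
    pt x y + pt x' y' = pt (x + x') (y + y') := rfl

theorem pt_sub (x x' : EuclideanSpace ℝ (Fin n)) (y y' : ℝ) :
    pt x y - pt x' y' = pt (x - x') (y - y') := rfl

theorem smul_pt (t : ℝ) (x : EuclideanSpace ℝ (Fin n)) (y : ℝ) :
    t • pt x y = pt (t • x) (t * y) := rfl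

theorem norm_sq_eq (z : Space n) : ‖z‖ ^ 2 = ‖z.fst‖ ^ 2 + z.snd ^ 2 := by
  rw [WithLp.prod_norm_sq_eq_of_L2, Real.norm_eq_abs z.snd, sq_abs]

theorem norm_fst_le (z : Space n) : ‖z.fst‖ ≤ ‖z‖ :=
  le_of_sq_le_sq (by nlinarith [norm_sq_eq z, sq_nonneg z.snd]) (norm_nonneg z)

theorem abs_snd_le (z : Space n) : |z.snd| ≤ ‖z‖ :=
  abs_le_of_sq_le_sq (by nlinarith [norm_sq_eq z, sq_nonneg ‖z.fst‖]) (norm_nonneg z)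

theorem norm_pt_zero (x : EuclideanSpace ℝ (Fin n)) : ‖pt x 0‖ = ‖x‖ := by
  have := norm_sq_eq (pt x 0)
  simp at this
  simpa using this

theorem inner_pt_left (x : EuclideanSpace ℝ (Fin n)) (y : ℝ) (z : Space n) :
    inner ℝ (pt x y) z = inner ℝ x z.fst + y * z.snd := by
  rw [WithLp.prod_inner_apply]
  simp [mul_comm]

theorem continuous_fst : Continuous fun z : Space n => z.fst := by fun_prop

theorem continuous_snd : Continuous fun z : Space n => z.snd := by fun_prop

theorem continuous_pt : Continuous fun p : EuclideanSpace ℝ (Fin n) × ℝ => pt p.1 p.2 := by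
  unfold pt
  fun_prop

theorem continuous_pt_left (y : ℝ) :
    Continuous fun x : EuclideanSpace ℝ (Fin n) => pt x y :=
  continuous_pt.comp (by fun_prop : Continuous fun x : EuclideanSpace ℝ (Fin n) => (x, y))

theorem continuous_pt_right (x : EuclideanSpace ℝ (Fin n)) : Continuous fun y : ℝ => pt x y :=
  continuous_pt.comp (by fun_prop : Continuous fun y : ℝ => (x, y))

theorem isOpen_cylinder {Ω : Set (EuclideanSpace ℝ (Fin n))} (hΩ : IsOpen Ω) :
    IsOpen (cylinder Ω) :=
  (hΩ.preimage continuous_fst).inter (isOpen_Ioi.preimage continuous_snd)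

theorem cylinder_eq_image (Ω : Set (EuclideanSpace ℝ (Fin n))) :
    cylinder Ω = (fun p : EuclideanSpace ℝ (Fin n) × ℝ => pt p.1 p.2) '' (Ω ×ˢ Set.Ioi 0) := by
  ext z
  constructor
  · intro hz
    exact ⟨(z.fst, z.snd), ⟨hz.1, hz.2⟩, rfl⟩
  · rintro ⟨p, hp, rfl⟩
    exact ⟨hp.1, hp.2⟩

theorem isPreconnected_cylinder {Ω : Set (EuclideanSpace ℝ (Fin n))} (hΩ : IsPreconnected Ω) :
    IsPreconnected (cylinder Ω) := by
  rw [cylinder_eq_image]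
  exact (hΩ.prod isPreconnected_Ioi).image _ continuous_pt.continuousOn

theorem convex_cylinder {Ω : Set (EuclideanSpace ℝ (Fin n))} (hΩ : Convex ℝ Ω) :
    Convex ℝ (cylinder Ω) := by
  intro z hz w hw a b ha hb hab
  exact ⟨hΩ hz.1 hw.1 ha hb hab, convex_Ioi (0 : ℝ) hz.2 hw.2 ha hb hab⟩

theorem cylinder_mono {Ω Ω' : Set (EuclideanSpace ℝ (Fin n))} (h : Ω ⊆ Ω') :
    cylinder Ω ⊆ cylinder Ω' := fun _ hz => ⟨h hz.1, hz.2⟩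

theorem closure_cylinder (Ω : Set (EuclideanSpace ℝ (Fin n))) :
    closure (cylinder Ω) = {z | z.fst ∈ closure Ω ∧ 0 ≤ z.snd} := by
  apply Set.Subset.antisymm
  · refine closure_minimal (fun z hz => ⟨subset_closure hz.1, le_of_lt hz.2⟩) ?_
    exact (isClosed_closure.preimage continuous_fst).inter (isClosed_Ici.preimage continuous_snd)
  · intro z hz
    rw [cylinder_eq_image]
    refine image_closure_subset_closure_image continuous_pt ⟨(z.fst, z.snd), ?_, rfl⟩
    rw [closure_prod_eq, closure_Ioi]
    exact ⟨hz.1, hz.2⟩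

/-- The unit vector of the vertical direction. -/
noncomputable def vert (n : ℕ) : Space n := pt 0 1

theorem inner_vert (z : Space n) : inner ℝ (vert n) z = z.snd := by
  rw [vert, inner_pt_left]
  simp

theorem norm_vert : ‖vert n‖ = 1 := by
  have h : ‖vert n‖ ^ 2 = 1 ^ 2 := by rw [norm_sq_eq]; simp [vert]
  exact (pow_left_inj₀ (norm_nonneg _) zero_le_one two_ne_zero).1 h

/-- A uniform interior tangent ball exists at a smooth boundary point. -/
theorem exists_interior_ball {Ω : Set (EuclideanSpace ℝ (Fin n))}
    {P ν : EuclideanSpace ℝ (Fin n)} (hP : P ∈ frontier Ω) (hν : IsUnitOuterNormal Ω P ν) :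
    ‖ν‖ = 1 ∧ ∃ R > 0, Metric.ball (P - R • ν) R ⊆ Ω := by
  obtain ⟨ρ, ⟨U, hU, hPU, hρ, hgrad, hiff⟩, rfl⟩ := hν
  set g := ∇ ρ P with hg
  have hg0 : 0 < ‖g‖ := norm_pos_iff.2 hgrad
  have hν1 : ‖‖g‖⁻¹ • g‖ = 1 := by
    rw [norm_smul, norm_inv, norm_norm, inv_mul_cancel₀ hg0.ne']
  refine ⟨hν1, ?_⟩
  have hUn : U ∈ 𝓝 P := hU.mem_nhds hPU
  have hsm : ContDiffAt ℝ ∞ ρ P := hρ.contDiffAt hUn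
  have hP0 : ρ P ≤ 0 := by
    have hcl : P ∈ closure Ω := frontier_subset_closure hP
    have hfreq : ∃ᶠ x in 𝓝 P, ρ x ≤ 0 := by
      refine ((mem_closure_iff_frequently.1 hcl).and_eventually hUn).mono ?_
      rintro x ⟨hx, hxU⟩
      exact ((hiff x hxU).1 hx).le
    by_contra! h
    obtain ⟨x, hx1, hx2⟩ :=
      (hfreq.and_eventually (hsm.continuousAt.eventually (lt_mem_nhds h))).exists
    linarith
  -- A locally Lipschitz derivative, together with ρ P ≤ 0, gives the Taylor bound ρ(P + h) ≤ ⟨g, h⟩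
  -- + K|h|².
  obtain ⟨K, t, ht, hK⟩ := ((hsm.fderiv_right (m := 1) (by norm_cast)).exists_lipschitzOnWith)
  obtain ⟨r, hr, hball⟩ := Metric.mem_nhds_iff.1 (inter_mem ht hUn)
  have hTaylor : ∀ h : EuclideanSpace ℝ (Fin n), ‖h‖ < r →
      ρ (P + h) ≤ inner ℝ g h + K * ‖h‖ ^ 2 := by
    intro h hh
    have hdiff : ∀ x ∈ Metric.closedBall P ‖h‖, DifferentiableAt ℝ ρ x := fun x hx =>
      (hρ.contDiffAt (hU.mem_nhds (hball
        (Metric.closedBall_subset_ball hh hx)).2)).differentiableAt (by simp)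
    have hbound : ∀ x ∈ Metric.closedBall P ‖h‖, ‖fderiv ℝ ρ x - fderiv ℝ ρ P‖ ≤ K * ‖h‖ := by
      intro x hx
      have hxt := (hball (Metric.closedBall_subset_ball hh hx)).1
      have hPt := (hball (Metric.mem_ball_self hr)).1
      refine (hK.norm_sub_le hxt hPt).trans ?_
      gcongr
      simpa [dist_eq_norm] using hx
    have := (convex_closedBall P ‖h‖).norm_image_sub_le_of_norm_fderiv_le' hdiff hbound
      (Metric.mem_closedBall_self (norm_nonneg h)) (y := P + h) (by simp)
    have h2 := (le_abs_self _).trans this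
    have h3 : fderiv ℝ ρ P h = inner ℝ g h := by
      rw [hg, gradient, InnerProductSpace.toDual_symm_apply]
    simp only [add_sub_cancel_left, h3] at h2
    nlinarith
  -- The ball has diameter 2R < r, so the Taylor bound applies in it. In it |h|² < -2R⟨ν, h⟩, so 2RK
  -- < ‖g‖ lets the linear term dominate the quadratic one.
  obtain ⟨R, hR, hRr, hRK⟩ : ∃ R : ℝ, 0 < R ∧ 2 * R < r ∧ 2 * R * K < ‖g‖ := by
    have h1 : ∀ᶠ R : ℝ in 𝓝[>] 0, 2 * R < r := by
      refine nhdsWithin_le_nhds ?_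
      have : ContinuousAt (fun R : ℝ => 2 * R) 0 := by fun_prop
      exact this.eventually (gt_mem_nhds (by simpa using hr))
    have h2 : ∀ᶠ R : ℝ in 𝓝[>] 0, 2 * R * K < ‖g‖ := by
      refine nhdsWithin_le_nhds ?_
      have : ContinuousAt (fun R : ℝ => 2 * R * K) 0 := by fun_prop
      exact this.eventually (gt_mem_nhds (by simpa using hg0))
    obtain ⟨R, h⟩ := ((h1.and h2).and self_mem_nhdsWithin).exists
    exact ⟨R, h.2, h.1.1, h.1.2⟩
  refine ⟨R, hR, fun x hx => ?_⟩
  set h := x - P with hh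
  set ν := ‖g‖⁻¹ • g with hνdef
  have hxP : x = P + h := by simp [hh]
  have hgν : g = ‖g‖ • ν := by rw [hνdef, smul_smul, mul_inv_cancel₀ hg0.ne', one_smul]
  have h1 : ‖h + R • ν‖ < R := by
    rw [Metric.mem_ball, dist_eq_norm] at hx
    rwa [show h + R • ν = x - (P - R • ν) by rw [hh]; abel]
  have hnorm : ‖h‖ < r := by
    have := norm_sub_le (h + R • ν) (R • ν)
    rw [add_sub_cancel_right, norm_smul, hν1, Real.norm_of_nonneg hR.le] at this
    linarith
  have hsq : ‖h‖ ^ 2 + 2 * R * inner ℝ ν h < 0 := by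
    have h2 := pow_lt_pow_left₀ h1 (norm_nonneg _) two_ne_zero
    rw [norm_add_sq_real, norm_smul, hν1, Real.norm_of_nonneg hR.le, inner_smul_right,
      real_inner_comm] at h2
    linarith
  have hin : inner ℝ g h = ‖g‖ * inner ℝ ν h := by
    conv_lhs => rw [hgν]
    rw [real_inner_smul_left]
  have hxU : x ∈ U := (hball (by rw [Metric.mem_ball, dist_eq_norm]; exact hnorm)).2
  rw [hiff x hxU, hxP]
  have hT := hTaylor h hnorm
  rw [hin] at hT
  have hneg : inner ℝ ν h < 0 := by nlinarith [sq_nonneg ‖h‖]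
  nlinarith [mul_le_mul_of_nonneg_right hRK.le (sq_nonneg ‖h‖), K.2, NNReal.coe_nonneg K]

end Geometry

/-! ### One-sided normal derivatives and barriers -/

section NormalDerivative

variable {F : Type*} [NormedAddCommGroup F] [NormedSpace ℝ F]

/-- The set V may have an irregular boundary, so the mean value inequality is applied in a convex
open subset, later a ball or the half-cylinder over a ball. -/
theorem IsC2Closure.hasFDerivWithinAt {V : Set F} {f : F → ℝ} (hf : IsC2Closure V f)
    {D : F → F →L[ℝ] ℝ} (hD : ContinuousOn D (closure V)) (hDV : Set.EqOn D (fderiv ℝ f) V)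
    {U : Set F} (hU : IsOpen U) (hUc : Convex ℝ U) (hUV : U ⊆ V) {p : F} (hp : p ∈ closure U) :
    HasFDerivWithinAt f (D p) (closure U) p := by
  refine hasFDerivWithinAt_closure_of_tendsto_fderiv
    (((hf.contDiffOn.differentiableOn (by norm_num))).mono hUV) hUc hU ?_ ?_
  · intro y hy
    exact (hf.continuousOn y (closure_mono hUV hy)).mono (hUV.trans subset_closure)
  · have h1 : Tendsto D (𝓝[U] p) (𝓝 (D p)) :=
      (hD p (closure_mono hUV hp)).mono (hUV.trans subset_closure)
    exact h1.congr' (eventually_nhdsWithin_of_forall fun y hy => hDV (hUV hy))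

/-- One-sided differentiability along a segment reaching the boundary. -/
theorem hasDerivWithinAt_line {f : F → ℝ} {L : F →L[ℝ] ℝ} {s : Set F} {p ν : F}
    (hf : HasFDerivWithinAt f L s p) {δ : ℝ} (hδ : 0 < δ)
    (hs : ∀ t ∈ Set.Icc (-δ) 0, p + t • ν ∈ s) :
    HasDerivWithinAt (fun t : ℝ => f (p + t • ν)) (L ν) (Set.Iic 0) 0 := by
  have hline : HasDerivWithinAt (fun t : ℝ => p + t • ν) ν (Set.Icc (-δ) 0) 0 := by
    simpa using (((hasDerivAt_id (0 : ℝ)).smul_const ν).const_add p).hasDerivWithinAt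
  have hf' : HasFDerivWithinAt f L s (p + (0 : ℝ) • ν) := by simpa using hf
  have := hf'.comp_hasDerivWithinAt (0 : ℝ) hline hs
  exact this.mono_of_mem_nhdsWithin (Icc_mem_nhdsLE (by linarith))

/-- A function which vanishes at a boundary point and lies above a barrier has a negative outer
normal derivative. -/
theorem deriv_neg_of_barrier_le {f : ℝ → ℝ} {f' l ε R : ℝ} (hf : HasDerivWithinAt f f' (Set.Iic 0) 0)
    (h0 : f 0 = 0) (hl : 0 < l) (hε : 0 < ε) (hR : 0 < R)
    (hle : ∀ t ∈ Set.Ioo (-R) 0, ε * (Real.exp (-l * (R + t) ^ 2) - Real.exp (-l * R ^ 2)) ≤ f t) :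
    f' < 0 := by
  set g : ℝ → ℝ := fun t => ε * (Real.exp (-l * (R + t) ^ 2) - Real.exp (-l * R ^ 2))
  have hg : HasDerivAt g (ε * (Real.exp (-l * R ^ 2) * (-l * (2 * R)))) 0 := by
    have h1 : HasDerivAt (fun t : ℝ => R + t) 1 0 := (hasDerivAt_id (0 : ℝ)).const_add R
    have h2 := (((h1.pow 2).const_mul (-l)).exp.sub_const (Real.exp (-l * R ^ 2))).const_mul ε
    simpa [g] using h2
  have hneg : ε * (Real.exp (-l * R ^ 2) * (-l * (2 * R))) < 0 := by
    have : 0 < ε * (Real.exp (-l * R ^ 2) * (l * (2 * R))) := by positivity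
    linarith
  refine lt_of_le_of_lt ?_ hneg
  rw [hasDerivWithinAt_iff_tendsto_slope, Set.Iic_sdiff_right] at hf
  have hg' := hg.hasDerivWithinAt (s := Set.Iic 0)
  rw [hasDerivWithinAt_iff_tendsto_slope, Set.Iic_sdiff_right] at hg'
  refine le_of_tendsto_of_tendsto hf hg' ?_
  filter_upwards [Ioo_mem_nhdsLT (show -R < 0 by linarith)] with t ht
  have hg0 : g 0 = 0 := by simp [g]
  rw [slope_def_field, slope_def_field, h0, hg0]
  -- Dividing by t < 0 reverses `hle`, so the slopes of f lie below those of the barrier.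
  refine div_le_div_of_nonpos_of_le (by linarith [ht.2]) ?_
  have := hle t ht
  simp only [sub_zero]
  exact this

theorem IsC2Closure.normalDeriv_neg {V : Set F} {f : F → ℝ} (hf : IsC2Closure V f)
    {U : Set F} (hU : IsOpen U) (hUc : Convex ℝ U) (hUV : U ⊆ V) {p ν : F}
    {l ε R : ℝ} (hl : 0 < l) (hε : 0 < ε) (hR : 0 < R)
    (hseg : ∀ t ∈ Set.Icc (-R) 0, p + t • ν ∈ closure U) (hp : f p = 0)
    (hle : ∀ t ∈ Set.Ioo (-R) 0,
      ε * (Real.exp (-l * (R + t) ^ 2) - Real.exp (-l * R ^ 2)) ≤ f (p + t • ν)) :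
    normalDeriv f p ν < 0 := by
  obtain ⟨D, hD, hDV⟩ := hf.fderiv_extends
  have hpU : p ∈ closure U := by simpa using hseg 0 ⟨by linarith, le_rfl⟩
  have h1 := hasDerivWithinAt_line (hf.hasFDerivWithinAt hD hDV hU hUc hUV hpU) hR hseg
  rw [normalDeriv, h1.derivWithin (uniqueDiffWithinAt_Iic 0)]
  exact deriv_neg_of_barrier_le h1 (by simpa using hp) hl hε hR hle

end NormalDerivative

end HalfCyl

/-! ### Propagation of positivity and classical comparison -/

namespace HalfCyl

variable {n : ℕ}

/-- Propagation of a lower bound along chains of balls, up to the base of the half-cylinder.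
Here `Low z r` stands for a positive lower bound in the part of the ball `B(z, r)` inside the
half-cylinder. -/
theorem exists_low_of_chain {Ω : Set (EuclideanSpace ℝ (Fin n))} (hΩo : IsOpen Ω)
    (hΩc : IsPreconnected Ω) (Low : Space n → ℝ → Prop)
    (mono : ∀ z z' r r', Low z r → Metric.ball z' r' ⊆ Metric.ball z r → Low z' r')
    (prop : ∀ z r R ρ, 0 < r → 0 ≤ z.snd → Low z r → 0 < ρ → ρ < R →
      Metric.ball z R ⊆ {z : Space n | z.fst ∈ Ω} → Low z ρ)
    (start : ∃ z ∈ cylinder Ω, ∃ r > 0, Low z r) {x : EuclideanSpace ℝ (Fin n)} (hx : x ∈ Ω) :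
    ∃ r > 0, Low (pt x 0) r := by
  set S : Set (Space n) := {z | ∃ r > 0, Low z r}
  have hSo : IsOpen S := by
    rw [Metric.isOpen_iff]
    rintro z ⟨r, hr, hz⟩
    refine ⟨r, hr, fun z' hz' => ⟨r - dist z' z, by simpa using hz', mono _ _ _ _ hz ?_⟩⟩
    exact Metric.ball_subset_ball' (by linarith)
  have hCS : cylinder Ω ⊆ S := by
    refine (isPreconnected_cylinder hΩc).subset_of_closure_inter_subset hSo ?_ ?_
    · obtain ⟨z, hz, hzS⟩ := start
      exact ⟨z, hz, hzS⟩
    · rintro z ⟨hzS, hzC⟩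
      obtain ⟨a, ha, hball⟩ := Metric.isOpen_iff.1 (isOpen_cylinder hΩo) z hzC
      obtain ⟨z₁, ⟨r, hr, hz₁⟩, hd⟩ := Metric.mem_closure_iff.1 hzS (a / 4) (by linarith)
      have hd' : dist z₁ z < a / 4 := by rwa [dist_comm]
      have hz₁C : z₁ ∈ cylinder Ω := hball (by rw [Metric.mem_ball]; linarith)
      -- Since z₁ is within a/4 of z, the ball B(z₁, a/2) lies in B(z, a), and B(z₁, 3a/8) contains
      -- B(z, a/8).
      have hlow := prop z₁ r (a / 2) (3 * a / 8) hr hz₁C.2.le hz₁ (by linarith) (by linarith)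
        (fun w hw => (hball (Metric.ball_subset_ball' (by linarith) hw)).1)
      exact ⟨a / 8, by linarith, mono _ _ _ _ hlow (Metric.ball_subset_ball' (by linarith))⟩
  obtain ⟨a, ha, hball⟩ := Metric.isOpen_iff.1 hΩo x hx
  -- A ball of radius a about this point may cross the base, since `prop` only asks that it lie in Ω
  -- × ℝ. Its concentric ball of radius a/2 contains B((x, 0), a/4).
  have hz : pt x (a / 4) ∈ cylinder Ω := ⟨hx, by simp; linarith⟩
  obtain ⟨r, hr, hlow⟩ := hCS hz
  have hlow' := prop _ r a (a / 2) hr hz.2.le hlow (by linarith) (by linarith) fun w hw => hball (by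
    rw [Metric.mem_ball, dist_eq_norm] at hw ⊢
    exact (norm_fst_le (w - pt x (a / 4))).trans_lt hw)
  refine ⟨a / 4, by linarith, mono _ _ _ _ hlow' (Metric.ball_subset_ball' ?_)⟩
  have : dist (pt x 0) (pt x (a / 4)) = a / 4 := by
    rw [dist_eq_norm, pt_sub, sub_self, show pt (0 : EuclideanSpace ℝ (Fin n)) (0 - a / 4)
      = (0 - a / 4) • vert n by rw [vert, smul_pt]; simp, norm_smul, norm_vert]
    simp [abs_of_pos ha]
  linarith

/-- An inequality between continuous functions which holds a.e. in an open set holds everywhere. -/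
theorem le_of_ae_le_of_continuousOn {Ω : Set (EuclideanSpace ℝ (Fin n))} (hΩ : IsOpen Ω)
    {f g : EuclideanSpace ℝ (Fin n) → ℝ} (hf : ContinuousOn f Ω) (hg : ContinuousOn g Ω)
    (h : ∀ᵐ x ∂(volume.restrict Ω), f x ≤ g x) {x : EuclideanSpace ℝ (Fin n)} (hx : x ∈ Ω) :
    f x ≤ g x := by
  have hopen : IsOpen (Ω ∩ (fun x => g x - f x) ⁻¹' Set.Iio 0) :=
    (hg.sub hf).isOpen_inter_preimage hΩ isOpen_Iio
  rw [ae_restrict_iff' hΩ.measurableSet] at h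
  have hnull : volume (Ω ∩ (fun x => g x - f x) ⁻¹' Set.Iio 0) = 0 := by
    refine measure_mono_null (fun y hy => ?_) h
    have h2 : g y - f y < 0 := hy.2
    simp only [Set.mem_compl_iff, Set.mem_ofPred_eq, not_forall]
    exact ⟨hy.1, by linarith⟩
  have hempty := (hopen.measure_eq_zero_iff volume).1 hnull
  by_contra! hlt
  have : x ∈ (∅ : Set (EuclideanSpace ℝ (Fin n))) := by
    rw [← hempty]
    exact ⟨hx, by simpa using hlt⟩
  exact this

/-- A right derivative at a right-sided local minimum is nonnegative. -/
theorem nonneg_of_hasDerivWithinAt_of_min {f : ℝ → ℝ} {f' : ℝ}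
    (hf : HasDerivWithinAt f f' (Set.Ici 0) 0) (hmin : ∀ᶠ y in 𝓝[>] 0, f 0 ≤ f y) : 0 ≤ f' := by
  rw [hasDerivWithinAt_iff_tendsto_slope, Set.Ici_sdiff_left] at hf
  refine ge_of_tendsto hf ?_
  filter_upwards [hmin, self_mem_nhdsWithin] with y hy hy0
  rw [slope_def_field]
  exact div_nonneg (by linarith) (by simpa using le_of_lt hy0)

theorem hasDerivAt_pt_right (x : EuclideanSpace ℝ (Fin n)) (y : ℝ) :
    HasDerivAt (fun y : ℝ => pt x y) (vert n) y := by
  have h := (((hasDerivAt_id y).smul_const (vert n)).const_add (pt x 0))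
  rw [one_smul] at h
  refine h.congr_of_eventuallyEq (Eventually.of_forall fun y => ?_)
  simp [vert, smul_pt, pt_add]

/-- Comparison with a barrier for classical supersolutions of the mixed problem. -/
theorem barrier_le_of_harmonic {Ω : Set (EuclideanSpace ℝ (Fin n))}
    {v : Space n → ℝ} (hcont : ContinuousOn v (closure (cylinder Ω)))
    (hharm : InnerProductSpace.HarmonicOnNhd v (cylinder Ω))
    (hv0 : ∀ z ∈ closure (cylinder Ω), 0 ≤ v z) {M : ℝ} (hM : 0 < M)
    (hbase : ∀ x ∈ Ω, ∃ d, HasDerivWithinAt (fun y => v (pt x y)) d (Set.Ici 0) 0 ∧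
      d ≤ M * v (pt x 0))
    {z₀ : Space n} (hz₀ : 0 ≤ z₀.snd) {r R δ : ℝ} (hr : 0 < r) (hR : 0 < R) (hδ : 0 < δ)
    (hlow : ∀ z ∈ cylinder Ω, z ∈ Metric.ball z₀ r → δ ≤ v z)
    (hball : Metric.ball z₀ R ⊆ {z : Space n | z.fst ∈ Ω}) :
    ∃ l > 0, ∃ ε > 0, ∀ ρ, 0 < ρ → ρ < R → ∀ z : Space n, 0 ≤ z.snd → ‖z - z₀‖ ≤ ρ →
      ε * barrier l ρ z₀ (M • vert n) z ≤ v z := by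
  set a := M • vert n with ha
  have hfin : (0 : ℝ) ≤ Module.finrank ℝ (Space n) := Nat.cast_nonneg _
  -- This makes the barrier strictly subharmonic outside radius r/2. Radius r/2, not r, keeps the
  -- inner sphere inside the open ball where `hlow` passes to the limit on the base.
  obtain ⟨l, hl⟩ : ∃ l, l = (2 * R * ‖a‖ + Module.finrank ℝ (Space n) + 1) / (2 * (r / 2) ^ 2) :=
    ⟨_, rfl⟩
  have hl0 : 0 < l := by rw [hl]; positivity
  have hl' : 2 * R * ‖a‖ + Module.finrank ℝ (Space n) < 2 * l * (r / 2) ^ 2 := by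
    rw [hl]; field_simp; linarith
  -- By `barrier_le` this gives εb ≤ δ throughout the ball, with ε independent of ρ.
  obtain ⟨ε, hε⟩ : ∃ ε, ε = δ / Real.exp (‖a‖ * (‖z₀‖ + R)) := ⟨_, rfl⟩
  have hε0 : 0 < ε := hε ▸ div_pos hδ (Real.exp_pos _)
  refine ⟨l, hl0, ε, hε0, fun ρ hρ hρR z hz hzρ => ?_⟩
  have hslab : ∀ w : Space n, ‖w - z₀‖ ≤ ρ → w.fst ∈ Ω := fun w hw =>
    hball (by rw [Metric.mem_ball, dist_eq_norm]; linarith)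
  have hclos : ∀ w : Space n, 0 ≤ w.snd → ‖w - z₀‖ ≤ ρ → w ∈ closure (cylinder Ω) := by
    intro w hw hwρ
    rw [closure_cylinder]
    exact ⟨subset_closure (hslab w hwρ), hw⟩
  have hinner : ∀ w : Space n, 0 ≤ w.snd → ‖w - z₀‖ ≤ ρ → ‖w - z₀‖ ≤ r / 2 →
      ε * barrier l ρ z₀ a w ≤ v w := by
    intro w hw hwρ hwr
    have hvw : δ ≤ v w := by
      have hwcl : w ∈ closure (cylinder Ω ∩ Metric.ball z₀ r) :=
        Metric.isOpen_ball.closure_inter ⟨hclos w hw hwρ, by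
          rw [Metric.mem_ball, dist_eq_norm]; linarith⟩
      have hcw : ContinuousWithinAt v (cylinder Ω ∩ Metric.ball z₀ r) w :=
        (hcont w (hclos w hw hwρ)).mono (Set.inter_subset_left.trans subset_closure)
      have : (𝓝[cylinder Ω ∩ Metric.ball z₀ r] w).NeBot := mem_closure_iff_nhdsWithin_neBot.1 hwcl
      exact ge_of_tendsto hcw (eventually_nhdsWithin_of_forall fun y hy => hlow y hy.1 hy.2)
    have hb := barrier_le (ρ := ρ) hl0 a (hwρ.trans hρR.le)
    calc ε * barrier l ρ z₀ a w ≤ ε * Real.exp (‖a‖ * (‖z₀‖ + R)) := by gcongr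
      _ = δ := by rw [hε]; field_simp
      _ ≤ v w := hvw
  set K : Set (Space n) := {w | ‖w - z₀‖ ≤ ρ ∧ 0 ≤ w.snd ∧ r / 2 ≤ ‖w - z₀‖}
  have hKc : IsCompact K := by
    have hcl : IsClosed {w : Space n | 0 ≤ w.snd ∧ r / 2 ≤ ‖w - z₀‖} :=
      (isClosed_Ici.preimage continuous_snd).inter
        (isClosed_le continuous_const (continuous_id.sub continuous_const).norm)
    have : K = Metric.closedBall z₀ ρ ∩ {w : Space n | 0 ≤ w.snd ∧ r / 2 ≤ ‖w - z₀‖} := by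
      ext w
      rw [Set.mem_inter_iff, Metric.mem_closedBall, dist_eq_norm]
      rfl
    rw [this]
    exact (isCompact_closedBall z₀ ρ).inter_right hcl
  have hKcl : K ⊆ closure (cylinder Ω) := fun w hw => hclos w hw.2.1 hw.1
  set d : Space n → ℝ := fun w => v w - ε * barrier l ρ z₀ a w with hd
  have hbc : Continuous (barrier l ρ z₀ a) := (contDiff_barrier l ρ z₀ a (m := 0)).continuous
  by_contra! hlt
  have hzK : z ∈ K := by
    refine ⟨hzρ, hz, ?_⟩
    by_contra! h
    exact absurd (hinner z hz hzρ h.le) (not_le.2 hlt)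
  -- A negative minimum of v - εb over the closed half-annulus is excluded on the outer sphere by b
  -- ≤ 0, on the inner one by v ≥ δ, on the base by the Robin inequality, and inside by the
  -- Laplacian.
  obtain ⟨w, hwK, hwmin⟩ := hKc.exists_isMinOn ⟨z, hzK⟩
    ((hcont.mono hKcl).sub (continuous_const.mul hbc).continuousOn : ContinuousOn d K)
  have hdw : d w < 0 := (hwmin hzK : d w ≤ d z).trans_lt (by change v z - _ < 0; linarith)
  have hwρ : ‖w - z₀‖ < ρ := by
    refine lt_of_le_of_ne hwK.1 fun h => ?_
    have h1 := barrier_nonpos hl0 hρ.le a h.ge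
    have h2 := hv0 w (hKcl hwK)
    simp only [hd] at hdw
    nlinarith
  have hwr : r / 2 < ‖w - z₀‖ := by
    refine lt_of_le_of_ne hwK.2.2 fun h => ?_
    have := hinner w hwK.2.1 hwK.1 h.ge
    simp only [hd] at hdw
    linarith
  have hnhd : ∀ᶠ w' in 𝓝 w, ‖w' - z₀‖ < ρ ∧ r / 2 < ‖w' - z₀‖ := by
    have hc : ContinuousAt (fun w' : Space n => ‖w' - z₀‖) w := by fun_prop
    exact (hc.eventually (gt_mem_nhds hwρ)).and (hc.eventually (lt_mem_nhds hwr))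
  rcases hwK.2.1.eq_or_lt with h0 | h0
  · obtain ⟨d₁, hd₁, hd₁M⟩ := hbase w.fst (hslab w hwK.1)
    have hw : w = pt w.fst 0 := by rw [h0]; rfl
    have hbar : HasDerivWithinAt (fun y : ℝ => barrier l ρ z₀ a (pt w.fst y))
        (fderiv ℝ (barrier l ρ z₀ a) (pt w.fst 0) (vert n)) (Set.Ici 0) 0 :=
      (((contDiff_barrier l ρ z₀ a (m := 1)).differentiable (by norm_num)).differentiableAt
        (x := pt w.fst 0)).hasFDerivAt.comp_hasDerivWithinAt (0 : ℝ)
          (hasDerivAt_pt_right w.fst 0).hasDerivWithinAt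
    have hdd : HasDerivWithinAt (fun y : ℝ => d (pt w.fst y)) _ (Set.Ici 0) 0 :=
      hd₁.sub (hbar.const_mul ε)
    -- At a base minimum ∂_y d ≥ 0, but the inequalities for v and b give ∂_y d ≤ M d < 0.
    have hge := nonneg_of_hasDerivWithinAt_of_min hdd (by
      have hc : Tendsto (fun y : ℝ => pt w.fst y) (𝓝[>] 0) (𝓝 w) := by
        have := (continuous_pt_right w.fst).tendsto 0
        rw [← hw] at this
        exact this.mono_left nhdsWithin_le_nhds
      filter_upwards [hc.eventually hnhd, self_mem_nhdsWithin] with y hy hy0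
      rw [← hw]
      exact hwmin ⟨hy.1.le, le_of_lt hy0, hy.2.le⟩)
    rw [fderiv_barrier, ← hw, ha, real_inner_smul_left, inner_vert, ← ha] at hge
    rw [← hw] at hd₁M
    have e1 : inner ℝ (w - z₀) (vert n) = -z₀.snd := by
      rw [real_inner_comm, inner_vert]
      change w.snd - z₀.snd = _
      rw [← h0, zero_sub]
    have e2 : (vert n).snd = 1 := rfl
    rw [e1, e2] at hge
    have : 0 ≤ 2 * l * Real.exp (gaussExponent l z₀ a w) * z₀.snd := by positivity
    have hMd : M * d w < 0 := mul_neg_of_pos_of_neg hM hdw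
    simp only [hd] at hMd
    nlinarith
  · have hwC : w ∈ cylinder Ω := ⟨hslab w hwK.1, h0⟩
    have hloc : IsLocalMin d w := by
      have hs : ∀ᶠ w' : Space n in 𝓝 w, 0 < w'.snd :=
        continuous_snd.continuousAt.eventually (lt_mem_nhds h0)
      filter_upwards [hnhd, hs] with w' h1 h2
      exact hwmin ⟨h1.1.le, h2.le, h1.2.le⟩
    have hvC := (hharm w hwC).1
    have hb2 : ContDiffAt ℝ 2 (barrier l ρ z₀ a) w := (contDiff_barrier l ρ z₀ a).contDiffAt
    have hb2' : ContDiffAt ℝ 2 (ε • barrier l ρ z₀ a) w := contDiffAt_const.smul hb2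
    have hdeq : d = v - ε • barrier l ρ z₀ a := rfl
    have hlap := laplacian_nonneg_of_isLocalMin (by rw [hdeq]; exact hvC.sub hb2') hloc
    rw [hdeq, hvC.laplacian_sub hb2', InnerProductSpace.laplacian_smul _ hb2,
      (hharm w hwC).2.eq_of_nhds] at hlap
    have := laplacian_barrier_pos (by linarith : 0 < r / 2) hl' hwr.le hwρ.le hρR.le
    have h3 := mul_pos hε0 this
    simp only [Pi.zero_apply, smul_eq_mul] at hlap
    linarith

theorem contDiff_snd_add_const (K : ℝ) {m : ℕ∞ω} : ContDiff ℝ m fun w : Space n => w.snd + K :=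
  (WithLp.sndL 2 ℝ (EuclideanSpace ℝ (Fin n)) ℝ).contDiff.add contDiff_const

theorem laplacian_snd_add_const (K : ℝ) (w : Space n) :
    Laplacian.laplacian (fun w : Space n => w.snd + K) w = 0 := by
  rw [laplacian_eq_sum_fderiv (stdOrthonormalBasis ℝ (Space n))
    (contDiff_snd_add_const K).contDiffAt]
  refine Finset.sum_eq_zero fun i _ => ?_
  have hfd : ∀ y : Space n, HasFDerivAt (fun w : Space n => w.snd + K)
      (WithLp.sndL 2 ℝ (EuclideanSpace ℝ (Fin n)) ℝ) y := fun y =>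
    (WithLp.sndL 2 ℝ (EuclideanSpace ℝ (Fin n)) ℝ).hasFDerivAt.add_const K
  simp only [fun y => (hfd y).fderiv]
  simp

/-- This corrector is strictly superharmonic for a ≠ 0. Over a bounded Ω, with horizontal a and K
large, it is at least y, so small multiples of it control infinity. -/
theorem laplacian_snd_add_const_sub_exp (K : ℝ) (a w : Space n) :
    Laplacian.laplacian (fun w : Space n => w.snd + K - Real.exp (gaussExponent 0 0 a w)) w
      = -(Real.exp (gaussExponent 0 0 a w) * ‖a‖ ^ 2) := by
  have h := ContDiffAt.laplacian_sub (x := w) (contDiff_snd_add_const K).contDiffAt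
    (contDiff_gaussExponent 0 0 a).exp.contDiffAt
  rw [laplacian_snd_add_const, laplacian_exp_gaussExponent] at h
  refine Eq.trans h ?_
  simp

/-- A bounded harmonic function in the half-cylinder is nonnegative if it is so on the boundary. -/
theorem nonneg_of_harmonic_of_bounded {Ω : Set (EuclideanSpace ℝ (Fin n))} (hΩo : IsOpen Ω)
    (hΩb : Bornology.IsBounded Ω) {v : Space n → ℝ}
    (hcont : ContinuousOn v (closure (cylinder Ω)))
    (hharm : InnerProductSpace.HarmonicOnNhd v (cylinder Ω)) {B : ℝ}
    (hB : ∀ z ∈ cylinder Ω, |v z| ≤ B)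
    (hlat : ∀ x ∈ frontier Ω, ∀ y : ℝ, 0 ≤ y → 0 ≤ v (pt x y))
    (hbase : ∀ x ∈ Ω, 0 ≤ v (pt x 0)) {e : EuclideanSpace ℝ (Fin n)} (he : e ≠ 0)
    {z : Space n} (hz : z ∈ cylinder Ω) : 0 ≤ v z := by
  set a : Space n := pt e 0 with ha
  have ha0 : 0 < ‖a‖ := by rw [ha, norm_pt_zero]; exact norm_pos_iff.2 he
  set g : Space n → ℝ := fun w => Real.exp (gaussExponent 0 0 a w) with hg
  have hga : ∀ w, g w = Real.exp (inner ℝ e w.fst) := by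
    intro w
    simp only [hg, gaussExponent, ha, inner_pt_left]
    simp
  obtain ⟨L, hL⟩ := hΩb.closure.exists_norm_le
  set K := Real.exp (‖e‖ * L)
  have hK : ∀ w : Space n, w.fst ∈ closure Ω → g w ≤ K := by
    intro w hw
    rw [hga]
    refine Real.exp_le_exp.2 ((real_inner_le_norm _ _).trans ?_)
    gcongr
    exact hL _ hw
  by_contra! hneg
  set q : Space n → ℝ := fun w => w.snd + K - Real.exp (gaussExponent 0 0 a w) with hq
  have hqz : 0 < q z := by
    have := hK z (subset_closure hz.1)
    have := hz.2
    simp only [hq, hg] at *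
    linarith
  -- With this ε the corrected function is still negative at z, where it equals v z / 2.
  obtain ⟨ε, hε⟩ : ∃ ε, ε = -v z / (2 * q z) := ⟨_, rfl⟩
  have hε0 : 0 < ε := hε ▸ div_pos (by linarith) (by linarith)
  have hεq : ε * q z = -v z / 2 := by rw [hε]; field_simp
  -- On the lid y = Y the correction exceeds the bound B, so no negative minimum lies there.
  obtain ⟨Y, hYz, hYB⟩ : ∃ Y, z.snd < Y ∧ B < ε * Y := by
    refine ⟨max (z.snd + 1) ((B + 1) / ε), by linarith [le_max_left (z.snd + 1) ((B + 1) / ε)], ?_⟩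
    have h1 := mul_le_mul_of_nonneg_left (le_max_right (z.snd + 1) ((B + 1) / ε)) hε0.le
    rw [mul_div_cancel₀ _ hε0.ne'] at h1
    linarith
  set T : Set (Space n) := {w | w.fst ∈ closure Ω ∧ 0 ≤ w.snd ∧ w.snd ≤ Y}
  have hTc : IsCompact T := by
    have h1 : IsCompact (closure Ω ×ˢ Set.Icc 0 Y) := hΩb.isCompact_closure.prod isCompact_Icc
    convert h1.image continuous_pt using 1
    ext w
    constructor
    · intro hw
      exact ⟨(w.fst, w.snd), ⟨hw.1, hw.2⟩, rfl⟩
    · rintro ⟨p, hp, rfl⟩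
      exact ⟨hp.1, hp.2⟩
  have hTcl : T ⊆ closure (cylinder Ω) := by
    rw [closure_cylinder]
    exact fun w hw => ⟨hw.1, hw.2.1⟩
  have hqC : ContDiff ℝ 2 q :=
    (contDiff_snd_add_const K).sub (contDiff_gaussExponent 0 0 a).exp
  set d : Space n → ℝ := v + ε • q with hd
  have hzT : z ∈ T := ⟨subset_closure hz.1, le_of_lt hz.2, hYz.le⟩
  obtain ⟨w, hwT, hwmin⟩ := hTc.exists_isMinOn ⟨z, hzT⟩
    ((hcont.mono hTcl).add (continuous_const.smul hqC.continuous).continuousOn :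
      ContinuousOn d T)
  have hdw : d w < 0 := by
    refine (hwmin hzT : d w ≤ d z).trans_lt ?_
    simp only [Pi.add_apply, Pi.smul_apply, smul_eq_mul, hεq]
    linarith
  have hdw' : v w + ε * q w < 0 := hdw
  have hqw : w.snd ≤ q w := by
    have := hK w hwT.1
    simp only [hq, hg] at *
    linarith
  have hεqw : ε * w.snd ≤ ε * q w := by gcongr
  have hεw : 0 ≤ ε * w.snd := mul_nonneg hε0.le hwT.2.1
  have hwΩ : w.fst ∈ Ω := by
    by_contra h
    have hfr : w.fst ∈ frontier Ω := by
      rw [hΩo.frontier_eq]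
      exact ⟨hwT.1, h⟩
    have := hlat w.fst hfr w.snd hwT.2.1
    rw [pt_eta] at this
    linarith
  have hw0 : 0 < w.snd := by
    refine lt_of_le_of_ne hwT.2.1 fun h => ?_
    have := hbase w.fst hwΩ
    rw [h, pt_eta] at this
    linarith
  have hwC : w ∈ cylinder Ω := ⟨hwΩ, hw0⟩
  have hwY : w.snd < Y := by
    refine lt_of_le_of_ne hwT.2.2 fun h => ?_
    have := (abs_le.1 (hB w hwC)).1
    rw [h] at hεqw
    linarith
  have hloc : IsLocalMin d w := by
    have h1 : ∀ᶠ w' : Space n in 𝓝 w, w'.snd < Y :=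
      continuous_snd.continuousAt.eventually (gt_mem_nhds hwY)
    filter_upwards [h1, (isOpen_cylinder hΩo).mem_nhds hwC] with w' h2 h3
    exact hwmin ⟨subset_closure h3.1, le_of_lt h3.2, h2.le⟩
  have hvC := (hharm w hwC).1
  have hqC' : ContDiffAt ℝ 2 (ε • q) w := contDiffAt_const.smul hqC.contDiffAt
  have hlap := laplacian_nonneg_of_isLocalMin (f := d) (hvC.add hqC') hloc
  have hlapq : Laplacian.laplacian q w = -(g w * ‖a‖ ^ 2) :=
    laplacian_snd_add_const_sub_exp K a w
  rw [hd, hvC.laplacian_add hqC', InnerProductSpace.laplacian_smul _ hqC.contDiffAt, hlapq,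
    (hharm w hwC).2.eq_of_nhds] at hlap
  have : 0 < ε * (g w * ‖a‖ ^ 2) := by
    have : 0 < g w := Real.exp_pos _
    positivity
  simp only [Pi.zero_apply, smul_eq_mul] at hlap
  linarith

end HalfCyl

/-! ### Boundary point lemma for classical solutions: part (ii) -/

namespace HalfCyl

variable {n : ℕ}

/-- A barrier of radius ρ' is bounded below by a positive constant on a strictly smaller ball, in
the region ⟨a, z⟩ ≥ 0; this is how comparison yields a new lower bound. -/
theorem barrier_ge {E : Type*} [NormedAddCommGroup E] [InnerProductSpace ℝ E] {l ρ ρ' : ℝ}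
    (hl : 0 < l) (hρ : 0 ≤ ρ) (hρ' : ρ ≤ ρ') {z₀ z a : E} (hz : ‖z - z₀‖ ≤ ρ)
    (ha : 0 ≤ inner ℝ a z) :
    Real.exp (-l * ρ ^ 2) - Real.exp (-l * ρ' ^ 2) ≤ barrier l ρ' z₀ a z := by
  rw [barrier_eq]
  have h1 : Real.exp (-l * ρ ^ 2) ≤ Real.exp (-l * ‖z - z₀‖ ^ 2) :=
    Real.exp_le_exp.2 (by nlinarith [pow_le_pow_left₀ (norm_nonneg _) hz 2])
  have h2 : Real.exp (-l * ρ' ^ 2) ≤ Real.exp (-l * ρ ^ 2) :=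
    Real.exp_le_exp.2 (by nlinarith [pow_le_pow_left₀ hρ hρ' 2])
  have h3 : 1 ≤ Real.exp (inner ℝ a z) := Real.one_le_exp ha
  nlinarith

theorem exp_sub_exp_pos {l ρ ρ' : ℝ} (hl : 0 < l) (hρ : 0 ≤ ρ) (hρ' : ρ < ρ') :
    0 < Real.exp (-l * ρ ^ 2) - Real.exp (-l * ρ' ^ 2) := by
  refine sub_pos.2 (Real.exp_lt_exp.2 ?_)
  nlinarith [pow_lt_pow_left₀ hρ' hρ two_ne_zero]

theorem barrier_pt_zero (l ρ M : ℝ) (x₀ x : EuclideanSpace ℝ (Fin n)) :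
    barrier l ρ (pt x₀ 0) (M • vert n) (pt x 0)
      = Real.exp (-l * ‖x - x₀‖ ^ 2) - Real.exp (-l * ρ ^ 2) := by
  rw [barrier_eq, real_inner_smul_left, inner_vert, pt_sub, sub_zero, norm_pt_zero]
  simp

/-- The ball of radius R touches ∂Ω, so comparison is made only for ρ < R. Since l and ε do not
depend on ρ, one may let ρ → R. -/
theorem exp_bound_of_lt {l ε s R V : ℝ} (hs : s < R)
    (h : ∀ ρ, s < ρ → ρ < R → ε * (Real.exp (-l * s ^ 2) - Real.exp (-l * ρ ^ 2)) ≤ V) :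
    ε * (Real.exp (-l * s ^ 2) - Real.exp (-l * R ^ 2)) ≤ V := by
  have hc : Tendsto (fun ρ : ℝ => ε * (Real.exp (-l * s ^ 2) - Real.exp (-l * ρ ^ 2))) (𝓝[<] R)
      (𝓝 (ε * (Real.exp (-l * s ^ 2) - Real.exp (-l * R ^ 2)))) := by
    have : Continuous fun ρ : ℝ => ε * (Real.exp (-l * s ^ 2) - Real.exp (-l * ρ ^ 2)) := by
      fun_prop
    exact (this.tendsto R).mono_left nhdsWithin_le_nhds
  refine le_of_tendsto hc ?_
  filter_upwards [Ioo_mem_nhdsLT hs] with ρ hρ using h ρ hρ.1 hρ.2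

/-- An essentially bounded function is bounded by a positive constant a.e. -/
theorem exists_ae_abs_le {α : Type*} [MeasurableSpace α] {μ : Measure α} {c : α → ℝ}
    (hc : MemLp c ⊤ μ) : ∃ M > 0, ∀ᵐ x ∂μ, |c x| ≤ M := by
  have hfin : eLpNormEssSup c μ < ⊤ := by
    rw [← eLpNorm_exponent_top]; exact hc.2
  refine ⟨(eLpNormEssSup c μ).toReal + 1, by positivity, ?_⟩
  filter_upwards [ae_le_eLpNormEssSup (f := c) (μ := μ)] with x hx
  have := ENNReal.toReal_mono hfin.ne hx
  rw [toReal_enorm, Real.norm_eq_abs] at this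
  linarith

/-- The outer normal derivative on the base, in terms of the extended derivative. -/
theorem IsC2Closure.hasDerivWithinAt_base {Ω : Set (EuclideanSpace ℝ (Fin n))} (hΩo : IsOpen Ω)
    {v : Space n → ℝ} (hv : IsC2Closure (cylinder Ω) v) {D : Space n → Space n →L[ℝ] ℝ}
    (hD : ContinuousOn D (closure (cylinder Ω))) (hDV : Set.EqOn D (fderiv ℝ v) (cylinder Ω))
    {x : EuclideanSpace ℝ (Fin n)} (hx : x ∈ Ω) :
    HasDerivWithinAt (fun y => v (pt x y)) (D (pt x 0) (vert n)) (Set.Ici 0) 0 ∧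
      normalDeriv v (pt x 0) (pt 0 (-1)) = -D (pt x 0) (vert n) := by
  obtain ⟨a, ha, hball⟩ := Metric.isOpen_iff.1 hΩo x hx
  have hcl : ∀ y : ℝ, 0 ≤ y → pt x y ∈ closure (cylinder (Metric.ball x a)) := by
    intro y hy
    rw [closure_cylinder]
    exact ⟨subset_closure (Metric.mem_ball_self ha), hy⟩
  have hF := hv.hasFDerivWithinAt hD hDV (isOpen_cylinder Metric.isOpen_ball)
    (convex_cylinder (convex_ball x a)) (cylinder_mono hball) (hcl 0 le_rfl)
  refine ⟨hF.comp_hasDerivWithinAt (0 : ℝ) (hasDerivAt_pt_right x 0).hasDerivWithinAt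
    fun y hy => hcl y hy, ?_⟩
  have h := hasDerivWithinAt_line (ν := pt 0 (-1)) hF one_pos (by
    intro t ht
    rw [smul_pt, pt_add, smul_zero, add_zero]
    exact hcl _ (by linarith [ht.2]))
  rw [normalDeriv, h.derivWithin (uniqueDiffWithinAt_Iic 0),
    show (pt 0 (-1) : Space n) = -vert n by
      rw [vert, ← neg_one_smul ℝ (pt 0 1 : Space n), smul_pt]; simp, map_neg]

/-- The boundary point lemma for bounded classical solutions in the half-cylinder. -/
theorem normalDeriv_neg_of_harmonic {Ω : Set (EuclideanSpace ℝ (Fin n))} (hΩo : IsOpen Ω)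
    (hΩc : IsPreconnected Ω) (hΩb : Bornology.IsBounded Ω) {c : EuclideanSpace ℝ (Fin n) → ℝ}
    (hc : MemLp c ⊤ (volume.restrict Ω)) {P ν : EuclideanSpace ℝ (Fin n)} (hP : P ∈ frontier Ω)
    (hν : IsUnitOuterNormal Ω P ν) {v : Space n → ℝ} (hv : IsC2Closure (cylinder Ω) v)
    {B : ℝ} (hB : ∀ z ∈ cylinder Ω, |v z| ≤ B) (hv1 : ∃ z ∈ cylinder Ω, v z ≠ 0)
    (hharm : InnerProductSpace.HarmonicOnNhd v (cylinder Ω))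
    (hlat : ∀ x ∈ frontier Ω, ∀ y : ℝ, 0 ≤ y → 0 ≤ v (pt x y))
    (hbase : ∀ x ∈ Ω, 0 ≤ v (pt x 0))
    (hneu : ∀ᵐ x ∂(volume.restrict Ω),
      0 ≤ normalDeriv v (pt x 0) (pt 0 (-1)) + c x * v (pt x 0))
    (hvP : v (pt P 0) = 0) : normalDeriv v (pt P 0) (pt ν 0) < 0 := by
  obtain ⟨hν1, R, hR, hball⟩ := exists_interior_ball hP hν
  have hν0 : ν ≠ 0 := by rintro rfl; simp at hν1
  have hint : ∀ z ∈ cylinder Ω, 0 ≤ v z := fun z hz =>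
    nonneg_of_harmonic_of_bounded hΩo hΩb hv.continuousOn hharm hB hlat hbase hν0 hz
  have hv0 : ∀ z ∈ closure (cylinder Ω), 0 ≤ v z := fun z hz => by
    have : (𝓝[cylinder Ω] z).NeBot := mem_closure_iff_nhdsWithin_neBot.1 hz
    exact ge_of_tendsto ((hv.continuousOn z hz).mono subset_closure)
      (eventually_nhdsWithin_of_forall hint)
  obtain ⟨M, hM, hcM⟩ := exists_ae_abs_le hc
  obtain ⟨D, hD, hDV⟩ := hv.fderiv_extends
  have hcl : ∀ x ∈ Ω, pt x 0 ∈ closure (cylinder Ω) := fun x hx => by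
    rw [closure_cylinder]
    exact ⟨subset_closure hx, le_rfl⟩
  have hbase' : ∀ x ∈ Ω, ∃ d, HasDerivWithinAt (fun y => v (pt x y)) d (Set.Ici 0) 0 ∧
      d ≤ M * v (pt x 0) := by
    intro x hx
    refine ⟨_, (hv.hasDerivWithinAt_base hΩo hD hDV hx).1, ?_⟩
    have hptc : ContinuousOn (fun x : EuclideanSpace ℝ (Fin n) => pt x 0) Ω :=
      (continuous_pt_left 0).continuousOn
    -- Replacing the merely bounded coefficient c by M, using v ≥ 0, leaves continuous functions on
    -- both sides, so the a.e. inequality holds everywhere.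
    refine le_of_ae_le_of_continuousOn hΩo (f := fun x => D (pt x 0) (vert n))
      (g := fun x => M * v (pt x 0)) ((hD.comp hptc hcl).clm_apply continuousOn_const)
      (continuousOn_const.mul (hv.continuousOn.comp hptc hcl)) ?_ hx
    filter_upwards [hneu, hcM, ae_restrict_mem hΩo.measurableSet] with y h1 h2 h3
    rw [(hv.hasDerivWithinAt_base hΩo hD hDV h3).2] at h1
    nlinarith [hbase y h3, (abs_le.1 h2).2]
  set Low : Space n → ℝ → Prop := fun z r =>
    ∃ δ > 0, ∀ w ∈ cylinder Ω, w ∈ Metric.ball z r → δ ≤ v w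
  have hx₀ : P - R • ν ∈ Ω := hball (Metric.mem_ball_self hR)
  have hlow := exists_low_of_chain hΩo hΩc Low
    (fun z z' r r' ⟨δ, hδ, h⟩ hsub => ⟨δ, hδ, fun w hw hw' => h w hw (hsub hw')⟩)
    (fun z r R ρ hr hz ⟨δ, hδ, h⟩ hρ hρR hsub => by
      obtain ⟨l, hl, ε, hε, hbar⟩ := barrier_le_of_harmonic hv.continuousOn hharm hv0 hM hbase' hz
        hr (hρ.trans hρR) hδ h hsub
      refine ⟨_, mul_pos hε (exp_sub_exp_pos hl hρ.le (by linarith : ρ < (ρ + R) / 2)),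
        fun w hw hwρ => ?_⟩
      rw [Metric.mem_ball, dist_eq_norm] at hwρ
      refine le_trans ?_ (hbar ((ρ + R) / 2) (by linarith) (by linarith) w hw.2.le (by linarith))
      refine mul_le_mul_of_nonneg_left (barrier_ge hl hρ.le (by linarith) hwρ.le ?_) hε.le
      rw [real_inner_smul_left, inner_vert]
      exact mul_nonneg hM.le hw.2.le)
    (by
      obtain ⟨z, hz, hvz⟩ := hv1
      have hpos : 0 < v z := lt_of_le_of_ne (hint z hz) hvz.symm
      have hcz : ContinuousAt v z := (hharm z hz).1.continuousAt
      obtain ⟨r, hr, hrb⟩ := Metric.mem_nhds_iff.1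
        (hcz.eventually (lt_mem_nhds (half_lt_self hpos)))
      exact ⟨z, hz, r, hr, v z / 2, half_pos hpos, fun w _ hw => le_of_lt (hrb hw)⟩) hx₀
  obtain ⟨r, hr, δ, hδ, hlow⟩ := hlow
  obtain ⟨l, hl, ε, hε, hbar⟩ := barrier_le_of_harmonic hv.continuousOn hharm hv0 hM hbase'
    (z₀ := pt (P - R • ν) 0) le_rfl hr hR hδ hlow (fun w hw => hball (by
      rw [Metric.mem_ball, dist_eq_norm] at hw ⊢
      exact (norm_fst_le (w - pt (P - R • ν) 0)).trans_lt hw))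
  have hline : ∀ t : ℝ, pt P 0 + t • pt ν 0 = pt (P + t • ν) 0 := fun t => by
    rw [smul_pt, pt_add]; simp
  have hdist : ∀ t : ℝ, -R ≤ t → ‖P + t • ν - (P - R • ν)‖ = R + t := fun t ht => by
    rw [show P + t • ν - (P - R • ν) = (R + t) • ν by rw [add_smul]; abel, norm_smul, hν1,
      Real.norm_of_nonneg (by linarith), mul_one]
  refine hv.normalDeriv_neg (isOpen_cylinder (Metric.isOpen_ball (x := P - R • ν) (ε := R)))
    (convex_cylinder (convex_ball _ _)) (cylinder_mono hball) hl hε hR (fun t ht => ?_) hvP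
    fun t ht => ?_
  · rw [hline, closure_cylinder, closure_ball _ hR.ne']
    refine ⟨?_, le_rfl⟩
    rw [pt_fst, Metric.mem_closedBall, dist_eq_norm, hdist t ht.1]
    linarith [ht.2]
  · rw [hline]
    refine exp_bound_of_lt (by linarith [ht.2]) fun ρ h1 h2 => ?_
    have hd := hdist t ht.1.le
    have := hbar ρ (by linarith [ht.1]) h2 (pt (P + t • ν) 0) le_rfl (by
      rw [pt_sub, sub_zero, norm_pt_zero, hd]; exact h1.le)
    rwa [barrier_pt_zero, hd] at this

end HalfCyl

/-! ### Fubini and the divergence theorem in the half-space -/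

namespace HalfCyl

variable {n : ℕ}

theorem isometry_pt_left (y : ℝ) : Isometry fun x : EuclideanSpace ℝ (Fin n) => pt x y :=
  Isometry.of_dist_eq fun x x' => by
    rw [dist_eq_norm, pt_sub, sub_self, norm_pt_zero, dist_eq_norm]

theorem isometry_pt_right (x : EuclideanSpace ℝ (Fin n)) : Isometry fun y : ℝ => pt x y :=
  Isometry.of_dist_eq fun y y' => by
    rw [dist_eq_norm, pt_sub, sub_self, show pt (0 : EuclideanSpace ℝ (Fin n)) (y - y')
      = (y - y') • vert n by rw [vert, smul_pt]; simp, norm_smul, norm_vert, mul_one, dist_eq_norm]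

theorem contDiff_pt_right (x : EuclideanSpace ℝ (Fin n)) {m : ℕ∞ω} :
    ContDiff ℝ m fun y : ℝ => pt x y := by
  have h : (fun y : ℝ => pt x y) = fun y => pt x 0 + y • vert n := by
    funext y
    simp [vert, smul_pt, pt_add]
  rw [h]
  exact contDiff_const.add (contDiff_id.smul contDiff_const)

theorem hasFDerivAt_pt_left (x : EuclideanSpace ℝ (Fin n)) (y : ℝ) :
    ∃ L : EuclideanSpace ℝ (Fin n) →L[ℝ] Space n, (∀ e, L e = pt e 0) ∧
      HasFDerivAt (fun x => pt x y) L x := by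
  set L : EuclideanSpace ℝ (Fin n) →L[ℝ] Space n :=
    { toFun := fun e => pt e 0
      map_add' := fun e e' => by rw [pt_add, add_zero]
      map_smul' := fun t e => by rw [RingHom.id_apply, smul_pt, mul_zero]
      cont := continuous_pt_left 0 }
  refine ⟨L, fun e => rfl, ?_⟩
  refine (L.hasFDerivAt.add_const (pt 0 y)).congr_of_eventuallyEq (Eventually.of_forall fun e => ?_)
  change _ = pt e 0 + pt 0 y
  rw [pt_add, add_zero, zero_add]

/-- Integration over the upper half-space as an iterated integral. -/
theorem setIntegral_halfSpace (f : Space n → ℝ) :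
    ∫ z in {z : Space n | 0 < z.snd}, f z
      = ∫ p, f (pt p.1 p.2) ∂(volume : Measure (EuclideanSpace ℝ (Fin n))).prod
          (volume.restrict (Set.Ioi (0 : ℝ))) := by
  have hmp := WithLp.volume_preserving_toLp (EuclideanSpace ℝ (Fin n)) ℝ
  have hme : MeasurableEmbedding (@WithLp.toLp 2 (EuclideanSpace ℝ (Fin n) × ℝ)) :=
    (MeasurableEquiv.toLp 2 (EuclideanSpace ℝ (Fin n) × ℝ)).measurableEmbedding
  rw [← hmp.setIntegral_preimage_emb hme]
  have hset : (@WithLp.toLp 2 (EuclideanSpace ℝ (Fin n) × ℝ)) ⁻¹' {z : Space n | 0 < z.snd}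
      = Set.univ ×ˢ Set.Ioi (0 : ℝ) := by
    ext p
    simp
  rw [hset, Measure.volume_eq_prod, ← Measure.prod_restrict, Measure.restrict_univ]
  rfl

theorem continuous_fderiv_apply {F : Space n → ℝ} (hF : ContDiff ℝ 1 F) (e : Space n) :
    Continuous fun z => fderiv ℝ F z e :=
  (hF.continuous_fderiv one_ne_zero).clm_apply continuous_const

theorem hasCompactSupport_fderiv_apply {F : Space n → ℝ} (hc : HasCompactSupport F)
    (e : Space n) : HasCompactSupport fun z => fderiv ℝ F z e :=
  (hc.fderiv ℝ).comp_left (g := fun L : Space n →L[ℝ] ℝ => L e) rfl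

theorem integrable_pt_of_hasCompactSupport {f : Space n → ℝ} (hf : Continuous f)
    (hc : HasCompactSupport f) :
    Integrable (fun p : EuclideanSpace ℝ (Fin n) × ℝ => f (pt p.1 p.2))
      ((volume : Measure (EuclideanSpace ℝ (Fin n))).prod (volume.restrict (Set.Ioi (0 : ℝ)))) := by
  have hmp := WithLp.volume_preserving_toLp (EuclideanSpace ℝ (Fin n)) ℝ
  have hme : MeasurableEmbedding (@WithLp.toLp 2 (EuclideanSpace ℝ (Fin n) × ℝ)) :=
    (MeasurableEquiv.toLp 2 (EuclideanSpace ℝ (Fin n) × ℝ)).measurableEmbedding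
  have h1 : Integrable f (volume : Measure (Space n)) := hf.integrable_of_hasCompactSupport hc
  have h2 := (hmp.integrable_comp_emb hme).2 h1
  rw [Measure.volume_eq_prod] at h2
  have h3 := h2.restrict (s := Set.univ ×ˢ Set.Ioi (0 : ℝ))
  rw [← Measure.prod_restrict, Measure.restrict_univ] at h3
  exact h3

/-- The divergence theorem in the upper half-space. -/
theorem setIntegral_halfSpace_fderiv {F : Space n → ℝ} (hF : ContDiff ℝ 1 F)
    (hc : HasCompactSupport F) (e : Space n) :
    ∫ z in {z : Space n | 0 < z.snd}, fderiv ℝ F z e = -(e.snd * ∫ x, F (pt x 0)) := by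
  have hint : ∀ e : Space n, Integrable (fun z => fderiv ℝ F z e)
      (volume.restrict {z : Space n | 0 < z.snd}) := fun e =>
    ((continuous_fderiv_apply hF e).integrable_of_hasCompactSupport
      (hasCompactSupport_fderiv_apply hc e)).restrict
  have hvert : ∫ z in {z : Space n | 0 < z.snd}, fderiv ℝ F z (vert n)
      = -∫ x, F (pt x 0) := by
    rw [setIntegral_halfSpace, integral_prod _ (integrable_pt_of_hasCompactSupport
      (continuous_fderiv_apply hF _) (hasCompactSupport_fderiv_apply hc _)), ← integral_neg]
    refine integral_congr_ae (Eventually.of_forall fun x => ?_)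
    have hder : ∀ y, deriv (fun y => F (pt x y)) y = fderiv ℝ F (pt x y) (vert n) := fun y =>
      ((hF.differentiable one_ne_zero _).hasFDerivAt.comp_hasDerivAt y
        (hasDerivAt_pt_right x y)).deriv
    have := HasCompactSupport.integral_Ioi_deriv_eq (hF.comp (contDiff_pt_right x))
      (hc.comp_isClosedEmbedding (isometry_pt_right x).isClosedEmbedding) 0
    simp only [← hder]
    exact this
  have hhor : ∀ e : EuclideanSpace ℝ (Fin n),
      ∫ z in {z : Space n | 0 < z.snd}, fderiv ℝ F z (pt e 0) = 0 := by
    intro e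
    rw [setIntegral_halfSpace, integral_prod_symm _ (integrable_pt_of_hasCompactSupport
      (continuous_fderiv_apply hF _) (hasCompactSupport_fderiv_apply hc _))]
    refine integral_eq_zero_of_ae (Eventually.of_forall fun y => ?_)
    have hdiff : ∀ x : EuclideanSpace ℝ (Fin n), HasFDerivAt (fun x => F (pt x y))
        (fderiv ℝ (fun x => F (pt x y)) x) x ∧
        fderiv ℝ (fun x => F (pt x y)) x e = fderiv ℝ F (pt x y) (pt e 0) := by
      intro x
      obtain ⟨L, hL, hLd⟩ := hasFDerivAt_pt_left x y
      have h := (hF.differentiable one_ne_zero (pt x y)).hasFDerivAt.comp x hLd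
      have h' : HasFDerivAt (fun x => F (pt x y)) ((fderiv ℝ F (pt x y)).comp L) x := h
      refine ⟨h'.differentiableAt.hasFDerivAt, ?_⟩
      rw [h'.fderiv, ContinuousLinearMap.comp_apply, hL]
    have hemb := (isometry_pt_left (n := n) y).isClosedEmbedding
    have hi1 : Integrable fun x : EuclideanSpace ℝ (Fin n) => fderiv ℝ F (pt x y) (pt e 0) :=
      ((continuous_fderiv_apply hF _).comp (continuous_pt_left y)).integrable_of_hasCompactSupport
        ((hasCompactSupport_fderiv_apply hc (pt e 0)).comp_isClosedEmbedding hemb)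
    have hi2 : Integrable fun x : EuclideanSpace ℝ (Fin n) => F (pt x y) :=
      (hF.continuous.comp (continuous_pt_left y)).integrable_of_hasCompactSupport
        (hc.comp_isClosedEmbedding hemb)
    -- Integration by parts against the constant 1 shows that horizontal derivatives integrate to
    -- zero on each slice.
    have := integral_mul_fderiv_eq_neg_fderiv_mul_of_integrable (μ := volume)
      (f := fun _ : EuclideanSpace ℝ (Fin n) => (1 : ℝ)) (g := fun x => F (pt x y)) (v := e)
      (by simp) (by simpa only [one_mul, (hdiff _).2] using hi1) (by simpa using hi2)
      (fun x _ => differentiableAt_const _) (fun x _ => (hdiff x).1.differentiableAt)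
    simpa [(hdiff _).2] using this
  have hsplit : ∀ z : Space n, fderiv ℝ F z e
      = fderiv ℝ F z (pt e.fst 0) + e.snd * fderiv ℝ F z (vert n) := by
    intro z
    have he : e = pt e.fst 0 + e.snd • vert n := by
      rw [vert, smul_pt, pt_add, smul_zero, add_zero, zero_add, mul_one, pt_eta]
    conv_lhs => rw [he]
    rw [map_add, map_smul, smul_eq_mul]
  simp only [hsplit]
  rw [integral_add (hint _) ((hint _).const_mul _), hhor, zero_add, integral_const_mul, hvert]
  ring

end HalfCyl

/-! ### Poincaré, trace and Green formulas for test functions -/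

namespace HalfCyl

variable {n : ℕ} {Ω : Set (EuclideanSpace ℝ (Fin n))}

theorem measurableSet_halfSpace : MeasurableSet {z : Space n | 0 < z.snd} :=
  (isOpen_Ioi.preimage continuous_snd).measurableSet

/-- Test functions vanish off Ω × ℝ, so the half-space divergence theorem serves for the cylinder
and no regularity of ∂Ω enters. -/
theorem setIntegral_cylinder {f : Space n → ℝ} (hf : ∀ z : Space n, z.fst ∉ Ω → f z = 0) :
    ∫ z in {z : Space n | 0 < z.snd}, f z = ∫ z in cylinder Ω, f z :=
  setIntegral_eq_of_subset_of_forall_sdiff_eq_zero measurableSet_halfSpace (fun _ hz => hz.2)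
    fun z hz => hf z fun h => hz.2 ⟨h, hz.1⟩

theorem continuous_gradient {f : Space n → ℝ} (hf : ContDiff ℝ 1 f) : Continuous (∇ f) :=
  (InnerProductSpace.toDual ℝ (Space n)).symm.continuous.comp
    (hf.continuous_fderiv one_ne_zero)

theorem hasCompactSupport_gradient {f : Space n → ℝ} (hf : HasCompactSupport f) :
    HasCompactSupport (∇ f) :=
  (hf.fderiv ℝ).comp_left (g := (InnerProductSpace.toDual ℝ (Space n)).symm) (map_zero _)

theorem memLp_of_test {F : Type*} [NormedAddCommGroup F] {f : Space n → F} (hf : Continuous f)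
    (hc : HasCompactSupport f) {p : ℝ≥0∞} (S : Set (Space n)) :
    MemLp f p (volume.restrict S) :=
  (hf.memLp_of_hasCompactSupport hc).restrict S

theorem continuous_laplacian {w : Space n → ℝ} (hw : ContDiff ℝ 2 w) :
    Continuous (Laplacian.laplacian w) := by
  set b := stdOrthonormalBasis ℝ (Space n)
  have : Laplacian.laplacian w
      = fun z => ∑ i, fderiv ℝ (fun y => fderiv ℝ w y (b i)) z (b i) := by
    funext z
    exact laplacian_eq_sum_fderiv b hw.contDiffAt
  rw [this]
  exact continuous_finsetSum _ fun i _ => continuous_fderiv_apply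
    ((hw.fderiv_right (m := 1) (by norm_num)).clm_apply contDiff_const) _

theorem hasCompactSupport_laplacian {w : Space n → ℝ} (hc : HasCompactSupport w) :
    HasCompactSupport (Laplacian.laplacian w) := by
  refine hc.mono' fun z hz => ?_
  by_contra h
  have h0 : w =ᶠ[𝓝 z] fun _ => 0 := notMem_tsupport_iff_eventuallyEq.1 h
  refine hz ?_
  rw [(InnerProductSpace.laplacian_congr_nhds h0).eq_of_nhds]
  simp

namespace IsTestFunction

variable {ψ : Space n → ℝ}

theorem eq_zero (hψ : IsTestFunction Ω ψ) {z : Space n} (hz : z.fst ∉ Ω) : ψ z = 0 :=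
  image_eq_zero_of_notMem_tsupport fun h => hz (hψ.tsupport_subset h)

theorem fderiv_eq_zero (hψ : IsTestFunction Ω ψ) {z : Space n} (hz : z.fst ∉ Ω) :
    fderiv ℝ ψ z = 0 :=
  image_eq_zero_of_notMem_tsupport fun h =>
    hz (hψ.tsupport_subset (tsupport_fderiv_subset ℝ h))

theorem gradient_eq_zero (hψ : IsTestFunction Ω ψ) {z : Space n} (hz : z.fst ∉ Ω) :
    ∇ ψ z = 0 := by
  rw [gradient, hψ.fderiv_eq_zero hz, map_zero]

theorem contDiff_one (hψ : IsTestFunction Ω ψ) : ContDiff ℝ 1 ψ := hψ.contDiff.of_le (by norm_cast)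

theorem memLp (hψ : IsTestFunction Ω ψ) : MemLp ψ 2 (volume.restrict (cylinder Ω)) :=
  memLp_of_test hψ.contDiff.continuous hψ.hasCompactSupport _

theorem memLp_gradient (hψ : IsTestFunction Ω ψ) :
    MemLp (∇ ψ) 2 (volume.restrict (cylinder Ω)) :=
  memLp_of_test (continuous_gradient hψ.contDiff_one)
    (hasCompactSupport_gradient hψ.hasCompactSupport) _

theorem memLp_trace (hψ : IsTestFunction Ω ψ) :
    MemLp (fun x => ψ (pt x 0)) 2 (volume.restrict Ω) :=
  ((hψ.contDiff.continuous.comp (continuous_pt_left 0)).memLp_of_hasCompactSupport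
    (hψ.hasCompactSupport.comp_isClosedEmbedding
      (isometry_pt_left 0).isClosedEmbedding)).restrict Ω

/-- Poincaré's inequality. -/
theorem integral_sq_le (hψ : IsTestFunction Ω ψ) {L : ℝ} (hL : ∀ x ∈ Ω, ‖x‖ ≤ L)
    {e : EuclideanSpace ℝ (Fin n)} (he : ‖e‖ = 1) :
    ∫ z in cylinder Ω, ψ z ^ 2 ≤ 4 * L ^ 2 * ∫ z in cylinder Ω, ‖∇ ψ z‖ ^ 2 := by
  set a : Space n := pt e 0 with ha
  have ha1 : ‖a‖ = 1 := by rw [ha, norm_pt_zero, he]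
  have hlin : ContDiff ℝ 1 fun z : Space n => inner ℝ a z := contDiff_const.inner ℝ contDiff_id
  have hψ1 := hψ.contDiff_one
  -- The horizontal field ⟨a, z⟩ψ² a has no flux through the base, so 0 = ∫ (ψ² + 2⟨a, z⟩ψ ∂ₐψ).
  have hF : ContDiff ℝ 1 fun z => inner ℝ a z * ψ z ^ 2 := hlin.mul (hψ1.pow 2)
  have hFc : HasCompactSupport fun z => inner ℝ a z * ψ z ^ 2 :=
    HasCompactSupport.mul_left (hψ.hasCompactSupport.comp_left (g := fun t : ℝ => t ^ 2) (by simp))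
  have hfd : ∀ z, fderiv ℝ (fun z => inner ℝ a z * ψ z ^ 2) z a
      = ψ z ^ 2 + 2 * inner ℝ a z * ψ z * fderiv ℝ ψ z a := by
    intro z
    have h1 : HasFDerivAt (fun z : Space n => inner ℝ a z) (innerSL ℝ a) z :=
      (innerSL ℝ a).hasFDerivAt
    have h2 := (hψ1.differentiable one_ne_zero z).hasFDerivAt.pow 2
    rw [(h1.fun_mul h2).fderiv]
    simp [ha1]
    ring
  have hdiv := setIntegral_halfSpace_fderiv hF hFc a
  simp only [hfd] at hdiv
  rw [setIntegral_cylinder (Ω := Ω) (fun z hz => by simp [hψ.eq_zero hz]),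
    show a.snd = 0 from rfl, zero_mul, neg_zero] at hdiv
  have hi1 : Integrable (fun z => ψ z ^ 2) (volume.restrict (cylinder Ω)) := hψ.memLp.integrable_sq
  have hi2 : Integrable (fun z => ‖∇ ψ z‖ ^ 2) (volume.restrict (cylinder Ω)) :=
    hψ.memLp_gradient.integrable_norm_pow (by norm_num)
  have hi3 : Integrable (fun z => ψ z ^ 2 + 2 * inner ℝ a z * ψ z * fderiv ℝ ψ z a)
      (volume.restrict (cylinder Ω)) := by
    have := ((continuous_fderiv_apply hF a).integrable_of_hasCompactSupport
      (μ := volume) (hasCompactSupport_fderiv_apply hFc a)).restrict (s := cylinder Ω)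
    simpa only [hfd] using this
  -- With X = ⟨a, z⟩∂ₐψ this is (ψ + 2X)² ≥ 0 together with |X| ≤ L|∇ψ|.
  have hle : ∫ z in cylinder Ω, ((1 / 2) * ψ z ^ 2 - 2 * L ^ 2 * ‖∇ ψ z‖ ^ 2)
      ≤ ∫ z in cylinder Ω, (ψ z ^ 2 + 2 * inner ℝ a z * ψ z * fderiv ℝ ψ z a) := by
    refine integral_mono ((hi1.const_mul _).sub (hi2.const_mul _)) hi3 fun z => ?_
    by_cases hz : z.fst ∈ Ω
    · have hLz : |inner ℝ a z| ≤ L := by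
        rw [ha, inner_pt_left, zero_mul, add_zero]
        refine (abs_real_inner_le_norm _ _).trans ?_
        rw [he, one_mul]
        exact hL _ hz
      have hd : |fderiv ℝ ψ z a| ≤ ‖∇ ψ z‖ := by
        rw [← inner_gradient_left]
        refine (abs_real_inner_le_norm _ _).trans ?_
        rw [ha1, mul_one]
      have h4 : |inner ℝ a z * fderiv ℝ ψ z a| ≤ L * ‖∇ ψ z‖ := by
        rw [abs_mul]
        exact mul_le_mul hLz hd (abs_nonneg _) ((abs_nonneg _).trans hLz)
      have h5 : (inner ℝ a z * fderiv ℝ ψ z a) ^ 2 ≤ (L * ‖∇ ψ z‖) ^ 2 :=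
        sq_le_sq' (abs_le.1 h4).1 (abs_le.1 h4).2
      nlinarith [sq_nonneg (ψ z + 2 * (inner ℝ a z * fderiv ℝ ψ z a))]
    · simp [hψ.eq_zero hz, hψ.gradient_eq_zero hz]
  rw [hdiv, integral_sub (hi1.const_mul _) (hi2.const_mul _), integral_const_mul,
    integral_const_mul] at hle
  linarith

/-- The trace inequality. -/
theorem integral_trace_sq_le (hψ : IsTestFunction Ω ψ) :
    ∫ x in Ω, ψ (pt x 0) ^ 2
      ≤ (∫ z in cylinder Ω, ψ z ^ 2) + ∫ z in cylinder Ω, ‖∇ ψ z‖ ^ 2 := by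
  have hψ1 := hψ.contDiff_one
  have hF : ContDiff ℝ 1 fun z => ψ z ^ 2 := hψ1.pow 2
  have hFc : HasCompactSupport fun z => ψ z ^ 2 :=
    hψ.hasCompactSupport.comp_left (g := fun t : ℝ => t ^ 2) (by simp)
  have hfd : ∀ z, fderiv ℝ (fun z => ψ z ^ 2) z (vert n) = 2 * ψ z * fderiv ℝ ψ z (vert n) := by
    intro z
    rw [((hψ1.differentiable one_ne_zero z).hasFDerivAt.pow 2).fderiv]
    simp
  -- The flux of ψ² through the base is -∫ 2ψ ∂_yψ, bounded by ∫ (ψ² + |∇ψ|²).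
  have hdiv := setIntegral_halfSpace_fderiv hF hFc (vert n)
  have hi3 := ((continuous_fderiv_apply hF (vert n)).integrable_of_hasCompactSupport
      (μ := volume) (hasCompactSupport_fderiv_apply hFc (vert n))).restrict (s := cylinder Ω)
  simp only [hfd] at hdiv hi3
  rw [setIntegral_cylinder (Ω := Ω) (fun z hz => by simp [hψ.eq_zero hz]),
    show (vert n).snd = 1 from rfl, one_mul] at hdiv
  have hΩ : ∫ x in Ω, ψ (pt x 0) ^ 2 = ∫ x, ψ (pt x 0) ^ 2 :=
    setIntegral_eq_integral_of_forall_compl_eq_zero fun x hx => by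
      rw [hψ.eq_zero (z := pt x 0) hx]; simp
  have hi1 : Integrable (fun z => ψ z ^ 2) (volume.restrict (cylinder Ω)) := hψ.memLp.integrable_sq
  have hi2 : Integrable (fun z => ‖∇ ψ z‖ ^ 2) (volume.restrict (cylinder Ω)) :=
    hψ.memLp_gradient.integrable_norm_pow (by norm_num)
  have hle : ∫ z in cylinder Ω, -(ψ z ^ 2 + ‖∇ ψ z‖ ^ 2)
      ≤ ∫ z in cylinder Ω, 2 * ψ z * fderiv ℝ ψ z (vert n) := by
    refine integral_mono (hi1.add hi2).neg hi3 fun z => ?_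
    have hd : |fderiv ℝ ψ z (vert n)| ≤ ‖∇ ψ z‖ := by
      rw [← inner_gradient_left]
      refine (abs_real_inner_le_norm _ _).trans ?_
      rw [norm_vert, mul_one]
    have h5 : (fderiv ℝ ψ z (vert n)) ^ 2 ≤ ‖∇ ψ z‖ ^ 2 :=
      sq_le_sq' (abs_le.1 hd).1 (abs_le.1 hd).2
    nlinarith [sq_nonneg (ψ z + fderiv ℝ ψ z (vert n))]
  rw [integral_neg, integral_add hi1 hi2, hdiv] at hle
  rw [hΩ]
  linarith

/-- Green's formula. -/
theorem integral_inner_gradient (hψ : IsTestFunction Ω ψ) {w : Space n → ℝ} (hw : ContDiff ℝ 2 w) :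
    ∫ z in cylinder Ω, inner ℝ (∇ w z) (∇ ψ z)
      = -(∫ z in cylinder Ω, Laplacian.laplacian w z * ψ z)
        - ∫ x in Ω, fderiv ℝ w (pt x 0) (vert n) * ψ (pt x 0) := by
  set b := stdOrthonormalBasis ℝ (Space n)
  have hψ1 := hψ.contDiff_one
  have hw' : ∀ e : Space n, ContDiff ℝ 1 fun z => fderiv ℝ w z e := fun e =>
    (hw.fderiv_right (m := 1) (by norm_num)).clm_apply contDiff_const
  -- The divergence theorem is applied to (∂ₑw)ψ for each e of an orthonormal basis. The sum yields
  -- Δw ψ + ∇w·∇ψ inside and (∂_y w)ψ on the base.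
  have hF : ∀ e, ContDiff ℝ 1 fun z => fderiv ℝ w z e * ψ z := fun e => (hw' e).mul hψ1
  have hFc : ∀ e, HasCompactSupport fun z => fderiv ℝ w z e * ψ z := fun e =>
    HasCompactSupport.mul_left hψ.hasCompactSupport
  have hfd : ∀ e z, fderiv ℝ (fun z => fderiv ℝ w z e * ψ z) z e
      = fderiv ℝ (fun z => fderiv ℝ w z e) z e * ψ z + fderiv ℝ w z e * fderiv ℝ ψ z e := by
    intro e z
    rw [(((hw' e).differentiable one_ne_zero z).hasFDerivAt.fun_mul
      (hψ1.differentiable one_ne_zero z).hasFDerivAt).fderiv]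
    simp
    ring
  have hi : ∀ e, Integrable (fun z => fderiv ℝ (fun z => fderiv ℝ w z e * ψ z) z e)
      (volume.restrict (cylinder Ω)) := fun e =>
    ((continuous_fderiv_apply (hF e) e).integrable_of_hasCompactSupport
      (hasCompactSupport_fderiv_apply (hFc e) e)).restrict
  have hdiv : ∀ e : Space n, ∫ z in cylinder Ω, fderiv ℝ (fun z => fderiv ℝ w z e * ψ z) z e
      = -∫ x in Ω, e.snd * (fderiv ℝ w (pt x 0) e * ψ (pt x 0)) := by
    intro e
    have hΩ : ∫ x in Ω, fderiv ℝ w (pt x 0) e * ψ (pt x 0)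
        = ∫ x, fderiv ℝ w (pt x 0) e * ψ (pt x 0) :=
      setIntegral_eq_integral_of_forall_compl_eq_zero fun x hx => by
        rw [hψ.eq_zero (z := pt x 0) hx, mul_zero]
    rw [integral_const_mul, hΩ, ← setIntegral_halfSpace_fderiv (hF e) (hFc e) e,
      setIntegral_cylinder]
    intro z hz
    rw [hfd, hψ.eq_zero hz, hψ.fderiv_eq_zero hz]
    simp
  have hsum : ∀ z, ∑ i, fderiv ℝ (fun z => fderiv ℝ w z (b i) * ψ z) z (b i)
      = Laplacian.laplacian w z * ψ z + inner ℝ (∇ w z) (∇ ψ z) := by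
    intro z
    simp only [hfd]
    rw [Finset.sum_add_distrib, ← Finset.sum_mul, laplacian_eq_sum_fderiv b hw.contDiffAt,
      ← b.sum_inner_mul_inner]
    congr 1
    refine Finset.sum_congr rfl fun i _ => ?_
    rw [inner_gradient_left, real_inner_comm, inner_gradient_left]
  have hbase : ∀ x, ∑ i, (b i).snd * (fderiv ℝ w (pt x 0) (b i) * ψ (pt x 0))
      = fderiv ℝ w (pt x 0) (vert n) * ψ (pt x 0) := by
    intro x
    conv_rhs => rw [← b.sum_repr' (vert n), map_sum, Finset.sum_mul]
    refine Finset.sum_congr rfl fun i _ => ?_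
    rw [map_smul, real_inner_comm, inner_vert, smul_eq_mul, mul_assoc]
  have hi1 : Integrable (fun z => Laplacian.laplacian w z * ψ z)
      (volume.restrict (cylinder Ω)) :=
    (((continuous_laplacian hw).mul hψ1.continuous).integrable_of_hasCompactSupport
      (HasCompactSupport.mul_left hψ.hasCompactSupport)).restrict
  have hi2 : Integrable (fun z => inner ℝ (∇ w z) (∇ ψ z)) (volume.restrict (cylinder Ω)) := by
    refine (Continuous.integrable_of_hasCompactSupport (μ := volume)
      ((continuous_gradient (hw.of_le (by norm_num))).inner (continuous_gradient hψ1))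
      ?_).restrict
    refine (hasCompactSupport_gradient hψ.hasCompactSupport).mono fun z hz => ?_
    contrapose! hz
    simp only [Function.mem_support, ne_eq, not_not] at hz ⊢
    rw [hz, inner_zero_right]
  have hi3 : ∀ e : Space n, Integrable (fun x => e.snd * (fderiv ℝ w (pt x 0) e * ψ (pt x 0)))
      (volume.restrict Ω) := by
    intro e
    refine Integrable.const_mul ?_ _
    exact (((hF e).continuous.comp (continuous_pt_left 0)).integrable_of_hasCompactSupport
      ((hFc e).comp_isClosedEmbedding (isometry_pt_left 0).isClosedEmbedding)).restrict
  have htot : ∑ i, ∫ z in cylinder Ω, fderiv ℝ (fun z => fderiv ℝ w z (b i) * ψ z) z (b i)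
      = ∑ i, -∫ x in Ω, (b i).snd * (fderiv ℝ w (pt x 0) (b i) * ψ (pt x 0)) :=
    Finset.sum_congr rfl fun i _ => hdiv (b i)
  rw [← integral_finsetSum _ (fun i _ => hi (b i)), Finset.sum_neg_distrib,
    ← integral_finsetSum _ (fun i _ => hi3 (b i))] at htot
  simp only [hsum, hbase] at htot
  rw [integral_add hi1 hi2] at htot
  linarith

end IsTestFunction

end HalfCyl

/-! ### Weak comparison by smooth truncation -/

namespace HalfCyl

section SquareIntegrable

variable {α F : Type*} [MeasurableSpace α] {μ : Measure α} [NormedAddCommGroup F]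

theorem eLpNorm_two_eq {f : α → F} (hf : MemLp f 2 μ) :
    eLpNorm f 2 μ = ENNReal.ofReal (√(∫ x, ‖f x‖ ^ 2 ∂μ)) := by
  rw [hf.eLpNorm_eq_integral_rpow_norm (by norm_num) (by norm_num), Real.sqrt_eq_rpow]
  simp

theorem tendsto_integral_norm_sq {h : ℕ → α → F} (hh : ∀ k, MemLp (h k) 2 μ)
    (hlim : Tendsto (fun k => eLpNorm (h k) 2 μ) atTop (𝓝 0)) :
    Tendsto (fun k => ∫ x, ‖h k x‖ ^ 2 ∂μ) atTop (𝓝 0) := by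
  have h1 := (ENNReal.tendsto_toReal ENNReal.zero_ne_top).comp hlim
  have h2 : Tendsto (fun k => √(∫ x, ‖h k x‖ ^ 2 ∂μ)) atTop (𝓝 0) := by
    refine h1.congr fun k => ?_
    rw [Function.comp_apply, eLpNorm_two_eq (hh k), ENNReal.toReal_ofReal (Real.sqrt_nonneg _)]
  have h3 := h2.pow 2
  rw [zero_pow two_ne_zero] at h3
  refine h3.congr fun k => Real.sq_sqrt (integral_nonneg fun x => by positivity)

theorem tendsto_integral_norm_mul_norm {f : α → F} {h : ℕ → α → F} (hf : MemLp f 2 μ)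
    (hh : ∀ k, MemLp (h k) 2 μ) (hlim : Tendsto (fun k => eLpNorm (h k) 2 μ) atTop (𝓝 0)) :
    Tendsto (fun k => ∫ x, ‖f x‖ * ‖h k x‖ ∂μ) atTop (𝓝 0) := by
  have h2 := (Real.continuous_sqrt.tendsto 0).comp (tendsto_integral_norm_sq hh hlim)
  rw [Real.sqrt_zero] at h2
  have h3 := h2.const_mul (√(∫ x, ‖f x‖ ^ 2 ∂μ))
  rw [mul_zero] at h3
  refine squeeze_zero (fun k => integral_nonneg fun x => by positivity) (fun k => ?_) h3
  have h4 := integral_mul_norm_le_Lp_mul_Lq (μ := μ) (f := f) (g := h k) Real.HolderConjugate.two_two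
    (by simpa using hf) (by simpa using hh k)
  simpa [Real.sqrt_eq_rpow] using h4

theorem integrable_norm_mul_norm {f h : α → F} (hf : MemLp f 2 μ) (hh : MemLp h 2 μ) :
    Integrable (fun x => ‖f x‖ * ‖h x‖) μ :=
  hf.norm.integrable_mul hh.norm

theorem integrable_inner_of_memLp {H : Type*} [NormedAddCommGroup H] [InnerProductSpace ℝ H]
    {f h : α → H} (hf : MemLp f 2 μ) (hh : MemLp h 2 μ) :
    Integrable (fun x => inner ℝ (f x) (h x)) μ :=
  (integrable_norm_mul_norm hf hh).mono' (hf.1.inner hh.1)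
    (Eventually.of_forall fun _ => norm_inner_le_norm _ _)

end SquareIntegrable

/-- The derivative is continuous and vanishes outside [0, 1]. The function replaces the positive
part in testing: smooth, monotone, Lipschitz, and zero exactly on t ≤ 0. -/
theorem exists_deriv_smoothTransition_le :
    ∃ C > 0, ∀ t, 0 ≤ deriv Real.smoothTransition t ∧ deriv Real.smoothTransition t ≤ C := by
  have hcont : Continuous (deriv Real.smoothTransition) :=
    (Real.smoothTransition.contDiff (n := 1)).continuous_deriv le_rfl
  obtain ⟨C, hC⟩ := (isCompact_Icc (a := (0 : ℝ)) (b := 1)).exists_bound_of_continuousOn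
    hcont.continuousOn
  refine ⟨max C 1, by positivity, fun t => ⟨Real.smoothTransition.monotone.deriv_nonneg, ?_⟩⟩
  by_cases ht : t ∈ Set.Icc (0 : ℝ) 1
  · exact (le_abs_self _).trans ((hC t ht).trans (le_max_left _ _))
  · have h0 : deriv Real.smoothTransition t = 0 := by
      rw [Set.mem_Icc, not_and_or, not_le, not_le] at ht
      rcases ht with ht | ht
      · have : Real.smoothTransition =ᶠ[𝓝 t] fun _ => 0 := by
          filter_upwards [gt_mem_nhds ht] with s hs using Real.smoothTransition.zero_of_nonpos hs.le
        rw [this.deriv_eq]; simp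
      · have : Real.smoothTransition =ᶠ[𝓝 t] fun _ => 1 := by
          filter_upwards [lt_mem_nhds ht] with s hs using Real.smoothTransition.one_of_one_le hs.le
        rw [this.deriv_eq]; simp
    rw [h0]; positivity

theorem abs_smoothTransition_sub_le {C : ℝ}
    (hC : ∀ t, 0 ≤ deriv Real.smoothTransition t ∧ deriv Real.smoothTransition t ≤ C) (s t : ℝ) :
    |Real.smoothTransition s - Real.smoothTransition t| ≤ C * |s - t| := by
  have := Convex.norm_image_sub_le_of_norm_deriv_le (s := Set.univ) (f := Real.smoothTransition)
    (C := C) (x := t) (y := s)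
    (fun x _ => (Real.smoothTransition.contDiff (n := 1)).differentiable one_ne_zero x)
    (fun x _ => by rw [Real.norm_of_nonneg (hC x).1]; exact (hC x).2) convex_univ trivial trivial
  simpa using this

/-- If ξ were v, the sign of d where v < w would make the left side nonpositive; replacing v by ξ
costs only the Lipschitz error. -/
theorem neg_mul_smoothTransition_le {C d w v ξ : ℝ}
    (hlip : ∀ s t, |Real.smoothTransition s - Real.smoothTransition t| ≤ C * |s - t|)
    (h : v < w → 0 ≤ d) :
    -(d * Real.smoothTransition (w - ξ)) ≤ C * (‖d‖ * ‖ξ - v‖) := by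
  have h1 : 0 ≤ d * Real.smoothTransition (w - v) := by
    rcases lt_or_ge v w with hvw | hvw
    · exact mul_nonneg (h hvw) (Real.smoothTransition.nonneg _)
    · rw [Real.smoothTransition.zero_of_nonpos (by linarith), mul_zero]
  have h2 := hlip (w - v) (w - ξ)
  rw [show w - v - (w - ξ) = ξ - v by ring] at h2
  have h3 : d * (Real.smoothTransition (w - v) - Real.smoothTransition (w - ξ))
      ≤ |d| * (C * |ξ - v|) := by
    refine (le_abs_self _).trans ?_
    rw [abs_mul]
    gcongr
  rw [Real.norm_eq_abs, Real.norm_eq_abs]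
  linarith

/-- As β is Lipschitz, β(w - ξₖ) → β(w - v) in L², so the latter vanishes a.e., and β vanishes only
on t ≤ 0. -/
theorem ae_le_of_tendsto_smoothTransition {α : Type*} [MeasurableSpace α] {μ : Measure α}
    {w v : α → ℝ} {ξ : ℕ → α → ℝ} (hw : MemLp w 2 μ) (hv : MemLp v 2 μ)
    (hξ : ∀ k, MemLp (ξ k) 2 μ)
    (h1 : Tendsto (fun k => ∫ x, Real.smoothTransition (w x - ξ k x) ^ 2 ∂μ) atTop (𝓝 0))
    (h2 : Tendsto (fun k => eLpNorm (fun x => ξ k x - v x) 2 μ) atTop (𝓝 0)) :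
    ∀ᵐ x ∂μ, w x ≤ v x := by
  obtain ⟨C, hC, hβ⟩ := exists_deriv_smoothTransition_le
  set β := Real.smoothTransition with hβdef
  have hlip : ∀ s t, |β s - β t| ≤ C * |s - t| := abs_smoothTransition_sub_le hβ
  have hmem : ∀ f : α → ℝ, MemLp f 2 μ → MemLp (fun x => β (w x - f x)) 2 μ := fun f hf => by
    refine MemLp.of_le_mul (c := C) (hw.sub hf)
      (Real.smoothTransition.continuous.comp_aestronglyMeasurable (hw.sub hf).1)
      (Eventually.of_forall fun x => ?_)
    have := hlip (w x - f x) 0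
    simpa [hβdef] using this
  have hlim := (h1.const_mul 2).add
    ((tendsto_integral_norm_sq (fun k => (hξ k).sub hv) h2).const_mul (2 * C ^ 2))
  simp only [mul_zero, add_zero] at hlim
  have hle : ∫ x, β (w x - v x) ^ 2 ∂μ ≤ 0 := by
    refine ge_of_tendsto' hlim fun k => ?_
    have i1 := (hmem _ (hξ k)).integrable_sq
    have i2 := ((hξ k).sub hv).integrable_norm_pow (p := 2) (by norm_num)
    rw [← integral_const_mul, ← integral_const_mul,
      ← integral_add (i1.const_mul 2) (i2.const_mul (2 * C ^ 2))]
    refine integral_mono (hmem _ hv).integrable_sq ((i1.const_mul 2).add (i2.const_mul _))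
      fun x => ?_
    have h3 := hlip (w x - v x) (w x - ξ k x)
    have h4 : (β (w x - v x) - β (w x - ξ k x)) ^ 2 ≤ (C * |ξ k x - v x|) ^ 2 := by
      rw [show w x - v x - (w x - ξ k x) = ξ k x - v x by ring] at h3
      exact sq_le_sq' (abs_le.1 h3).1 (abs_le.1 h3).2
    rw [mul_pow] at h4
    simp only [Pi.sub_apply, Real.norm_eq_abs]
    nlinarith [sq_nonneg (β (w x - v x) - 2 * β (w x - ξ k x))]
  have hzero := (integral_eq_zero_iff_of_nonneg (fun x => sq_nonneg (β (w x - v x)))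
    (hmem _ hv).integrable_sq).1 (le_antisymm hle (integral_nonneg fun x => sq_nonneg _))
  filter_upwards [hzero] with x hx
  have : β (w x - v x) = 0 := by simpa using hx
  linarith [Real.smoothTransition.zero_iff_nonpos.1 this]

variable {n : ℕ} {Ω : Set (EuclideanSpace ℝ (Fin n))}

theorem contDiff_smoothTransition : ContDiff ℝ ∞ Real.smoothTransition :=
  Real.smoothTransition.contDiff (n := ⊤)

/-- Truncations of smooth functions by test functions are test functions. -/
theorem isTestFunction_smoothTransition_sub {w ξ : Space n → ℝ} (hw : ContDiff ℝ ∞ w)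
    {K : Set (Space n)} (hK : IsCompact K) (hKΩ : K ⊆ {z : Space n | z.fst ∈ Ω})
    (hwK : ∀ z ∉ K, w z ≤ 0) (hξ : IsTestFunction Ω ξ) :
    IsTestFunction Ω fun z => Real.smoothTransition (w z - ξ z) := by
  have hcpt : IsCompact (K ∪ tsupport ξ) := hK.union hξ.hasCompactSupport
  have hsupp : tsupport (fun z => Real.smoothTransition (w z - ξ z)) ⊆ K ∪ tsupport ξ := by
    refine closure_minimal (fun z hz => ?_) hcpt.isClosed
    by_contra h
    rw [Set.mem_union, not_or] at h
    refine hz (Real.smoothTransition.zero_of_nonpos ?_)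
    rw [image_eq_zero_of_notMem_tsupport h.2, sub_zero]
    exact hwK z h.1
  exact ⟨contDiff_smoothTransition.comp (hw.sub hξ.contDiff),
    hcpt.of_isClosed_subset (isClosed_tsupport _) hsupp,
    hsupp.trans (Set.union_subset hKΩ hξ.tsupport_subset)⟩

theorem gradient_smoothTransition_sub {w ξ : Space n → ℝ} (hw : ContDiff ℝ 1 w)
    (hξ : ContDiff ℝ 1 ξ) (z : Space n) :
    ∇ (fun z => Real.smoothTransition (w z - ξ z)) z
      = deriv Real.smoothTransition (w z - ξ z) • (∇ w z - ∇ ξ z) := by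
  have h1 := (hw.differentiable one_ne_zero z).hasFDerivAt.fun_sub
    (hξ.differentiable one_ne_zero z).hasFDerivAt
  have h2 : HasDerivAt Real.smoothTransition (deriv Real.smoothTransition (w z - ξ z))
      (w z - ξ z) :=
    ((Real.smoothTransition.contDiff (n := 1)).differentiable one_ne_zero _).hasDerivAt
  have h3 : HasFDerivAt (fun z => Real.smoothTransition (w z - ξ z))
      (deriv Real.smoothTransition (w z - ξ z) • (fderiv ℝ w z - fderiv ℝ ξ z)) z :=
    HasDerivAt.comp_hasFDerivAt (h₂ := Real.smoothTransition) z h2 h1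
  rw [gradient, h3.fderiv, map_smul, map_sub]
  rfl

/-- Weak comparison: the `H¹` solution of the mixed problem lies above a smooth function
which is subharmonic, with the opposite inequality for the conormal derivative, where it is
larger than the solution. -/
theorem ae_le_of_weak_solution (hΩb : Bornology.IsBounded Ω)
    {e : EuclideanSpace ℝ (Fin n)} (he : ‖e‖ = 1)
    {v : Space n → ℝ} {G : Space n → Space n} {u g : EuclideanSpace ℝ (Fin n) → ℝ}
    (hH : IsH1ZeroLateral Ω v G u) (hg : MemLp g 2 (volume.restrict Ω))
    (hweak : ∀ ξ : Space n → ℝ, IsTestFunction Ω ξ →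
      ∫ z in cylinder Ω, inner ℝ (G z) (∇ ξ z) = ∫ x in Ω, g x * ξ (pt x 0))
    {w : Space n → ℝ} (hw : ContDiff ℝ ∞ w) (hwc : HasCompactSupport w) {K : Set (Space n)}
    (hK : IsCompact K) (hKΩ : K ⊆ {z : Space n | z.fst ∈ Ω}) (hwK : ∀ z ∉ K, w z ≤ 0)
    (hsub : ∀ᵐ z ∂(volume.restrict (cylinder Ω)), v z < w z → 0 ≤ Laplacian.laplacian w z)
    (hneu : ∀ᵐ x ∂(volume.restrict Ω), u x < w (pt x 0) →
      0 ≤ fderiv ℝ w (pt x 0) (vert n) + g x) :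
    (∀ᵐ z ∂(volume.restrict (cylinder Ω)), w z ≤ v z) ∧
      ∀ᵐ x ∂(volume.restrict Ω), w (pt x 0) ≤ u x := by
  obtain ⟨hv, hG, hu, ξ, hξ, hξv, hξG, hξu⟩ := hH
  obtain ⟨C, hC, hβ⟩ := exists_deriv_smoothTransition_le
  obtain ⟨L, hL⟩ := hΩb.exists_norm_le
  set β := Real.smoothTransition
  have hlip : ∀ s t, |β s - β t| ≤ C * |s - t| := abs_smoothTransition_sub_le hβ
  have hw1 : ContDiff ℝ 1 w := hw.of_le (by norm_cast)
  have hw2 : ContDiff ℝ 2 w := hw.of_le (by norm_cast)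
  have hwG : MemLp (∇ w) 2 (volume.restrict (cylinder Ω)) :=
    memLp_of_test (continuous_gradient hw1) (hasCompactSupport_gradient hwc) _
  have hwL : MemLp (Laplacian.laplacian w) 2 (volume.restrict (cylinder Ω)) :=
    memLp_of_test (continuous_laplacian hw2) (hasCompactSupport_laplacian hwc) _
  have hwN : MemLp (fun x => fderiv ℝ w (pt x 0) (vert n)) 2 (volume.restrict Ω) :=
    (((continuous_fderiv_apply hw1 _).comp (continuous_pt_left 0)).memLp_of_hasCompactSupport
      ((hasCompactSupport_fderiv_apply hwc (vert n)).comp_isClosedEmbedding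
        (isometry_pt_left 0).isClosedEmbedding)).restrict Ω
  have hwm : MemLp w 2 (volume.restrict (cylinder Ω)) := memLp_of_test hw.continuous hwc _
  have hwt : MemLp (fun x => w (pt x 0)) 2 (volume.restrict Ω) :=
    ((hw.continuous.comp (continuous_pt_left 0)).memLp_of_hasCompactSupport
      (hwc.comp_isClosedEmbedding (isometry_pt_left 0).isClosedEmbedding)).restrict Ω
  set ψ : ℕ → Space n → ℝ := fun k z => β (w z - ξ k z) with hψdef
  have hψ : ∀ k, IsTestFunction Ω (ψ k) := fun k =>
    isTestFunction_smoothTransition_sub hw hK hKΩ hwK (hξ k)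
  have hdv : ∀ k, MemLp (fun z => ξ k z - v z) 2 (volume.restrict (cylinder Ω)) := fun k =>
    (hξ k).memLp.sub hv
  have hdG : ∀ k, MemLp (fun z => ∇ (ξ k) z - G z) 2 (volume.restrict (cylinder Ω)) := fun k =>
    (hξ k).memLp_gradient.sub hG
  have hdu : ∀ k, MemLp (fun x => ξ k (pt x 0) - u x) 2 (volume.restrict Ω) := fun k =>
    (hξ k).memLp_trace.sub hu
  -- The total error of using ξₖ in place of v: two linear terms from the signs of Δw and of the
  -- conormal data, and one quadratic term from the gradients.
  set E : ℕ → ℝ := fun k =>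
    2 * C ^ 2 * (∫ z in cylinder Ω, ‖Laplacian.laplacian w z‖ * ‖ξ k z - v z‖)
      + 2 * C ^ 2 * (∫ x in Ω, ‖fderiv ℝ w (pt x 0) (vert n) + g x‖ * ‖ξ k (pt x 0) - u x‖)
      + C ^ 2 * ∫ z in cylinder Ω, ‖∇ (ξ k) z - G z‖ ^ 2 with hE
  have hElim : Tendsto E atTop (𝓝 0) := by
    have h1 := (tendsto_integral_norm_mul_norm hwL hdv hξv).const_mul (2 * C ^ 2)
    have h2 := (tendsto_integral_norm_mul_norm (hwN.add hg) hdu hξu).const_mul (2 * C ^ 2)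
    have h3 := (tendsto_integral_norm_sq hdG hξG).const_mul (C ^ 2)
    have := (h1.add h2).add h3
    simp only [mul_zero, add_zero] at this
    exact this
  have hgrad : ∀ k, ∫ z in cylinder Ω, ‖∇ (ψ k) z‖ ^ 2 ≤ E k := by
    intro k
    have iψ : Integrable (fun z => ‖∇ (ψ k) z‖ ^ 2) (volume.restrict (cylinder Ω)) :=
      (hψ k).memLp_gradient.integrable_norm_pow (by norm_num)
    have iG : Integrable (fun z => ‖∇ (ξ k) z - G z‖ ^ 2) (volume.restrict (cylinder Ω)) :=
      (hdG k).integrable_norm_pow (by norm_num)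
    have i1 : Integrable (fun z => inner ℝ (∇ w z) (∇ (ψ k) z)) (volume.restrict (cylinder Ω)) :=
      integrable_inner_of_memLp hwG (hψ k).memLp_gradient
    have i2 : Integrable (fun z => inner ℝ (G z) (∇ (ψ k) z)) (volume.restrict (cylinder Ω)) :=
      integrable_inner_of_memLp hG (hψ k).memLp_gradient
    have i3 : Integrable (fun z => Laplacian.laplacian w z * ψ k z)
        (volume.restrict (cylinder Ω)) := hwL.integrable_mul (hψ k).memLp
    have i4 : Integrable (fun x => fderiv ℝ w (pt x 0) (vert n) * ψ k (pt x 0))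
        (volume.restrict Ω) := hwN.integrable_mul (hψ k).memLp_trace
    have i5 : Integrable (fun x => g x * ψ k (pt x 0)) (volume.restrict Ω) :=
      hg.integrable_mul (hψ k).memLp_trace
    -- As 0 ≤ β' ≤ C, one has |∇ψ|² ≤ C⟨∇w - ∇ξ, ∇ψ⟩. Writing ∇ξ = G + (∇ξ - G), Young's inequality
    -- absorbs half of |∇ψ|².
    have hpt : ∀ z, ‖∇ (ψ k) z‖ ^ 2 ≤ 2 * C * (inner ℝ (∇ w z) (∇ (ψ k) z)
        - inner ℝ (G z) (∇ (ψ k) z)) + C ^ 2 * ‖∇ (ξ k) z - G z‖ ^ 2 := by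
      intro z
      have hgr : ∇ (ψ k) z = deriv β (w z - ξ k z) • (∇ w z - ∇ (ξ k) z) :=
        gradient_smoothTransition_sub hw1 (hξ k).contDiff_one z
      have ha : ‖∇ (ψ k) z‖ ^ 2 ≤ C * inner ℝ (∇ w z - ∇ (ξ k) z) (∇ (ψ k) z) := by
        rw [hgr, norm_smul, mul_pow, real_inner_smul_right, real_inner_self_eq_norm_sq,
          Real.norm_of_nonneg (hβ _).1, ← mul_assoc, sq (deriv β _)]
        gcongr
        · exact (hβ _).1
        · exact (hβ _).2
      have hb : inner ℝ (∇ w z - ∇ (ξ k) z) (∇ (ψ k) z) = inner ℝ (∇ w z) (∇ (ψ k) z)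
          - inner ℝ (G z) (∇ (ψ k) z) - inner ℝ (∇ (ξ k) z - G z) (∇ (ψ k) z) := by
        simp only [inner_sub_left]
        ring
      have hd := (abs_le.1 (abs_real_inner_le_norm (∇ (ξ k) z - G z) (∇ (ψ k) z))).1
      rw [hb] at ha
      nlinarith [sq_nonneg (‖∇ (ψ k) z‖ - C * ‖∇ (ξ k) z - G z‖)]
    have i12 : Integrable (fun z => inner ℝ (∇ w z) (∇ (ψ k) z) - inner ℝ (G z) (∇ (ψ k) z))
        (volume.restrict (cylinder Ω)) := i1.sub i2
    have hint : ∫ z in cylinder Ω, ‖∇ (ψ k) z‖ ^ 2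
        ≤ ∫ z in cylinder Ω, (2 * C * (inner ℝ (∇ w z) (∇ (ψ k) z)
          - inner ℝ (G z) (∇ (ψ k) z)) + C ^ 2 * ‖∇ (ξ k) z - G z‖ ^ 2) :=
      integral_mono iψ ((i12.const_mul (2 * C)).add (iG.const_mul (C ^ 2))) hpt
    have hsplit : ∫ z in cylinder Ω, (2 * C * (inner ℝ (∇ w z) (∇ (ψ k) z)
        - inner ℝ (G z) (∇ (ψ k) z)) + C ^ 2 * ‖∇ (ξ k) z - G z‖ ^ 2)
        = 2 * C * ((∫ z in cylinder Ω, inner ℝ (∇ w z) (∇ (ψ k) z))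
          - ∫ z in cylinder Ω, inner ℝ (G z) (∇ (ψ k) z))
          + C ^ 2 * ∫ z in cylinder Ω, ‖∇ (ξ k) z - G z‖ ^ 2 := by
      rw [integral_add (i12.const_mul (2 * C)) (iG.const_mul (C ^ 2)), integral_const_mul,
        integral_const_mul, integral_sub i1 i2]
    have hlapl : -(∫ z in cylinder Ω, Laplacian.laplacian w z * ψ k z)
        ≤ C * ∫ z in cylinder Ω, ‖Laplacian.laplacian w z‖ * ‖ξ k z - v z‖ := by
      rw [← integral_neg, ← integral_const_mul]
      refine integral_mono_ae i3.neg ((integrable_norm_mul_norm hwL (hdv k)).const_mul C) ?_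
      filter_upwards [hsub] with z hz
      exact neg_mul_smoothTransition_le hlip hz
    have hneum : -(∫ x in Ω, (fderiv ℝ w (pt x 0) (vert n) * ψ k (pt x 0) + g x * ψ k (pt x 0)))
        ≤ C * ∫ x in Ω, ‖fderiv ℝ w (pt x 0) (vert n) + g x‖ * ‖ξ k (pt x 0) - u x‖ := by
      rw [← integral_neg, ← integral_const_mul]
      refine integral_mono_ae (i4.add i5).neg
        ((integrable_norm_mul_norm (hwN.add hg) (hdu k)).const_mul C) ?_
      filter_upwards [hneu] with x hx
      rw [← add_mul]
      exact neg_mul_smoothTransition_le hlip hx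
    rw [integral_add i4 i5] at hneum
    rw [hsplit, (hψ k).integral_inner_gradient hw2, hweak _ (hψ k)] at hint
    simp only [hE]
    nlinarith
  have hgradlim : Tendsto (fun k => ∫ z in cylinder Ω, ‖∇ (ψ k) z‖ ^ 2) atTop (𝓝 0) :=
    squeeze_zero (fun k => integral_nonneg fun z => by positivity) hgrad hElim
  have hψlim : Tendsto (fun k => ∫ z in cylinder Ω, ψ k z ^ 2) atTop (𝓝 0) := by
    have := hgradlim.const_mul (4 * L ^ 2)
    rw [mul_zero] at this
    exact squeeze_zero (fun k => integral_nonneg fun z => by positivity)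
      (fun k => (hψ k).integral_sq_le hL he) this
  have hψtlim : Tendsto (fun k => ∫ x in Ω, ψ k (pt x 0) ^ 2) atTop (𝓝 0) := by
    have := hψlim.add hgradlim
    rw [add_zero] at this
    exact squeeze_zero (fun k => integral_nonneg fun z => by positivity)
      (fun k => (hψ k).integral_trace_sq_le) this
  exact ⟨ae_le_of_tendsto_smoothTransition hwm hv (fun k => (hξ k).memLp) hψlim hξv,
    ae_le_of_tendsto_smoothTransition hwt hu (fun k => (hξ k).memLp_trace) hψtlim hξu⟩

end HalfCyl

/-! ### Boundary point lemma for the square root of the Laplacian: part (i) -/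

namespace HalfCyl

variable {n : ℕ} {Ω : Set (EuclideanSpace ℝ (Fin n))}

/-- Comparison with a barrier for weak solutions of the mixed problem. The barrier is centred
either above the base, or so that the solution is bounded below on the relevant part of the base. -/
theorem barrier_le_of_weak_solution (hΩb : Bornology.IsBounded Ω)
    {e : EuclideanSpace ℝ (Fin n)} (he : ‖e‖ = 1)
    {v : Space n → ℝ} {G : Space n → Space n} {u g : EuclideanSpace ℝ (Fin n) → ℝ}
    (hH : IsH1ZeroLateral Ω v G u) (hg : MemLp g 2 (volume.restrict Ω))
    (hweak : ∀ ξ : Space n → ℝ, IsTestFunction Ω ξ →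
      ∫ z in cylinder Ω, inner ℝ (G z) (∇ ξ z) = ∫ x in Ω, g x * ξ (pt x 0))
    (hv0 : ∀ᵐ z ∂(volume.restrict (cylinder Ω)), 0 ≤ v z)
    (hu0 : ∀ᵐ x ∂(volume.restrict Ω), 0 ≤ u x) {M : ℝ} (hM : 0 < M)
    (hgu : ∀ᵐ x ∂(volume.restrict Ω), -(M * u x) ≤ g x)
    {z₀ : Space n} {r R δ : ℝ} (hr : 0 < r) (hR : 0 < R) (hδ : 0 < δ)
    (hz₀ : 0 ≤ z₀.snd ∨
      ∀ᵐ x ∂(volume.restrict Ω), pt x 0 ∈ Metric.ball z₀ R → δ ≤ u x)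
    (hlow : ∀ᵐ z ∂(volume.restrict (cylinder Ω)), z ∈ Metric.ball z₀ r → δ ≤ v z)
    (hball : Metric.ball z₀ R ⊆ {z : Space n | z.fst ∈ Ω}) :
    ∃ l > 0, ∃ ε > 0, ∀ ρ, 0 < ρ → ρ < R →
      (∀ᵐ z ∂(volume.restrict (cylinder Ω)), ‖z - z₀‖ < ρ →
        ε * barrier l ρ z₀ (M • vert n) z ≤ v z) ∧
      ∀ᵐ x ∂(volume.restrict Ω), ‖pt x 0 - z₀‖ < ρ →
        ε * barrier l ρ z₀ (M • vert n) (pt x 0) ≤ u x := by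
  set a := M • vert n with ha
  have hfin : (0 : ℝ) ≤ Module.finrank ℝ (Space n) := Nat.cast_nonneg _
  obtain ⟨l, hl⟩ : ∃ l, l = (2 * R * ‖a‖ + Module.finrank ℝ (Space n) + 1) / (2 * r ^ 2) :=
    ⟨_, rfl⟩
  have hl0 : 0 < l := by rw [hl]; positivity
  have hl' : 2 * R * ‖a‖ + Module.finrank ℝ (Space n) < 2 * l * r ^ 2 := by
    rw [hl]; field_simp; linarith
  obtain ⟨ε, hε⟩ : ∃ ε, ε = δ / Real.exp (‖a‖ * (‖z₀‖ + R)) := ⟨_, rfl⟩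
  have hε0 : 0 < ε := hε ▸ div_pos hδ (Real.exp_pos _)
  refine ⟨l, hl0, ε, hε0, fun ρ hρ hρR => ?_⟩
  have hbδ : ∀ z, ‖z - z₀‖ < ρ → ε * barrier l ρ z₀ a z ≤ δ := fun z hz => by
    have hb := barrier_le (ρ := ρ) hl0 a (hz.le.trans hρR.le)
    calc ε * barrier l ρ z₀ a z ≤ ε * Real.exp (‖a‖ * (‖z₀‖ + R)) := by gcongr
      _ = δ := by rw [hε]; field_simp
  -- The cutoff equals 1 on the closed ball of radius R and only supplies compact support; beyond
  -- radius ρ the product is nonpositive anyway.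
  let χ : ContDiffBump z₀ := ⟨R, 2 * R, hR, by linarith⟩
  set w : Space n → ℝ := fun z => χ z * (ε * barrier l ρ z₀ a z) with hw
  have hbC : ContDiff ℝ ∞ (barrier l ρ z₀ a) := contDiff_barrier l ρ z₀ a
  have hwC : ContDiff ℝ ∞ w := χ.contDiff.mul (contDiff_const.mul hbC)
  have hwc : HasCompactSupport w := χ.hasCompactSupport.mul_right
  have hwout : ∀ z, ρ ≤ ‖z - z₀‖ → w z ≤ 0 := fun z hz =>
    mul_nonpos_of_nonneg_of_nonpos χ.nonneg
      (mul_nonpos_of_nonneg_of_nonpos hε0.le (barrier_nonpos hl0 hρ.le a hz))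
  have hwin : ∀ z, ‖z - z₀‖ < R → w =ᶠ[𝓝 z] ε • barrier l ρ z₀ a := by
    intro z hz
    have hc : ContinuousAt (fun z : Space n => ‖z - z₀‖) z := by fun_prop
    filter_upwards [hc.eventually (gt_mem_nhds hz)] with y hy
    have : χ y = 1 := χ.one_of_mem_closedBall (by
      rw [Metric.mem_closedBall, dist_eq_norm]; exact hy.le)
    simp [hw, this]
  have hbw : ∀ z, ‖z - z₀‖ < ρ → w z = ε * barrier l ρ z₀ a z := fun z hz =>
    (hwin z (hz.trans hρR)).eq_of_nhds
  obtain ⟨h1, h2⟩ := ae_le_of_weak_solution hΩb he hH hg hweak hwC hwc (isCompact_closedBall z₀ ρ)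
    ((Metric.closedBall_subset_ball hρR).trans hball)
    (fun z hz => hwout z (by
      rw [Metric.mem_closedBall, dist_eq_norm, not_le] at hz; exact hz.le))
    (by
      filter_upwards [hv0, hlow] with z hz0 hzlow hlt
      have hzρ : ‖z - z₀‖ < ρ := by
        by_contra! h
        linarith [hwout z h]
      have hzr : r ≤ ‖z - z₀‖ := by
        by_contra! h
        have := hzlow (by rw [Metric.mem_ball, dist_eq_norm]; exact h)
        linarith [hbδ z hzρ, hbw z hzρ]
      rw [(InnerProductSpace.laplacian_congr_nhds (hwin z (hzρ.trans hρR))).eq_of_nhds,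
        InnerProductSpace.laplacian_smul _ (hbC.of_le (by norm_cast)).contDiffAt]
      exact mul_nonneg hε0.le (laplacian_barrier_pos hr hl' hzr hzρ.le hρR.le).le)
    (by
      have hbase : ∀ᵐ x ∂(volume.restrict Ω), 0 ≤ z₀.snd ∨
          (pt x 0 ∈ Metric.ball z₀ R → δ ≤ u x) := by
        rcases hz₀ with h | h
        · exact Eventually.of_forall fun x => Or.inl h
        · exact h.mono fun x hx => Or.inr hx
      filter_upwards [hu0, hgu, hbase] with x hx0 hxg hxb hlt
      have hxρ : ‖pt x 0 - z₀‖ < ρ := by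
        by_contra! h
        linarith [hwout _ h]
      -- In the other alternative w ≤ δ ≤ u here, against u < w. So only centres at or above the
      -- base remain, where ∂_y w ≥ M w > M u ≥ -g.
      have hz₀' : 0 ≤ z₀.snd := by
        rcases hxb with h | h
        · exact h
        · have := h (by rw [Metric.mem_ball, dist_eq_norm]; exact hxρ.trans hρR)
          linarith [hbδ _ hxρ, hbw _ hxρ]
      rw [(hwin _ (hxρ.trans hρR)).fderiv_eq, fderiv_const_smul
        ((hbC.differentiable (by simp)).differentiableAt), smul_apply, fderiv_barrier,
        smul_eq_mul, mul_sub, ← mul_assoc, ← hbw _ hxρ, ha, real_inner_smul_left, inner_vert,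
        real_inner_comm, inner_vert, ← ha]
      have e1 : (pt x 0 - z₀).snd = -z₀.snd := by
        change 0 - z₀.snd = _
        ring
      have e2 : (vert n).snd = 1 := rfl
      rw [e1, e2]
      have : 0 ≤ ε * (2 * l * Real.exp (gaussExponent l z₀ a (pt x 0)) * z₀.snd) := by positivity
      nlinarith)
  refine ⟨?_, ?_⟩
  · filter_upwards [h1] with z hz hzρ
    rwa [← hbw z hzρ]
  · filter_upwards [h2] with x hx hxρ
    rwa [← hbw _ hxρ]

/-- The boundary point lemma for the square root of the Dirichlet Laplacian. -/
theorem normalDeriv_neg_of_sqrtDirichletLaplacian (hΩo : IsOpen Ω) (hΩc : IsPreconnected Ω)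
    (hΩb : Bornology.IsBounded Ω) {c : EuclideanSpace ℝ (Fin n) → ℝ}
    (hc : MemLp c ⊤ (volume.restrict Ω)) {u Au : EuclideanSpace ℝ (Fin n) → ℝ}
    (hu : IsC2Closure Ω u) (hu1 : ∃ x ∈ Ω, u x ≠ 0) (hAu : IsSqrtDirichletLaplacian Ω u Au)
    (hineq : ∀ᵐ x ∂(volume.restrict Ω), 0 ≤ Au x + c x * u x) (hu0 : ∀ x ∈ Ω, 0 ≤ u x)
    {P ν : EuclideanSpace ℝ (Fin n)} (hP : P ∈ frontier Ω) (huP : u P = 0)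
    (hν : IsUnitOuterNormal Ω P ν) : normalDeriv u P ν < 0 := by
  obtain ⟨hν1, R, hR, hball⟩ := exists_interior_ball hP hν
  obtain ⟨hg, v, G, hH, hweak⟩ := hAu
  obtain ⟨M, hM, hcM⟩ := exists_ae_abs_le hc
  have hu0' : ∀ᵐ x ∂(volume.restrict Ω), 0 ≤ u x :=
    (ae_restrict_mem hΩo.measurableSet).mono hu0
  have hgu : ∀ᵐ x ∂(volume.restrict Ω), -(M * u x) ≤ Au x := by
    filter_upwards [hineq, hcM, hu0'] with x h1 h2 h3
    nlinarith [(abs_le.1 h2).2]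
  have hucont : ContinuousOn u Ω := hu.contDiffOn.continuousOn
  have hv0 : ∀ᵐ z ∂(volume.restrict (cylinder Ω)), 0 ≤ v z := by
    -- Comparison with w = 0, the unit vector for Poincaré being the normal itself.
    refine (ae_le_of_weak_solution hΩb hν1 hH hg hweak (w := fun _ => 0) contDiff_const
      (HasCompactSupport.zero) isCompact_empty (Set.empty_subset _) (fun z _ => le_rfl)
      (Eventually.of_forall fun z _ => by simp) ?_).1
    filter_upwards [hu0'] with x hx hx'
    exact absurd hx (not_le.2 hx')
  have hbar := fun {z₀ : Space n} {r R δ : ℝ} => barrier_le_of_weak_solution hΩb hν1 hH hg hweak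
    hv0 hu0' hM hgu (z₀ := z₀) (r := r) (R := R) (δ := δ)
  have hslab : ∀ {x : EuclideanSpace ℝ (Fin n)} {y s : ℝ}, Metric.ball x s ⊆ Ω →
      Metric.ball (pt x y) s ⊆ {z : Space n | z.fst ∈ Ω} := fun {x y s} h w hw => h (by
    rw [Metric.mem_ball, dist_eq_norm] at hw ⊢
    exact (norm_fst_le (w - pt x y)).trans_lt hw)
  have hC : ∀ᵐ z ∂(volume.restrict (cylinder Ω)), z ∈ cylinder Ω :=
    ae_restrict_mem (isOpen_cylinder hΩo).measurableSet
  set Low : Space n → ℝ → Prop := fun z r =>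
    ∃ δ > 0, ∀ᵐ w ∂(volume.restrict (cylinder Ω)), w ∈ Metric.ball z r → δ ≤ v w
  have hpos : ∀ (z₀ : Space n) (l ε ρ ρ' : ℝ), 0 < l → 0 < ε → 0 < ρ → ρ < ρ' →
      (∀ᵐ z ∂(volume.restrict (cylinder Ω)), ‖z - z₀‖ < ρ' →
        ε * barrier l ρ' z₀ (M • vert n) z ≤ v z) → Low z₀ ρ := by
    intro z₀ l ε ρ ρ' hl hε hρ hρ' h
    refine ⟨_, mul_pos hε (exp_sub_exp_pos hl hρ.le hρ'), ?_⟩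
    filter_upwards [h, hC] with w hw hwC hwρ
    rw [Metric.mem_ball, dist_eq_norm] at hwρ
    refine le_trans ?_ (hw (by linarith))
    refine mul_le_mul_of_nonneg_left (barrier_ge hl hρ.le hρ'.le hwρ.le ?_) hε.le
    rw [real_inner_smul_left, inner_vert]
    exact mul_nonneg hM.le hwC.2.le
  have hmono : ∀ z z' r r', Low z r → Metric.ball z' r' ⊆ Metric.ball z r → Low z' r' :=
    fun z z' r r' ⟨δ, hδ, h⟩ hsub => ⟨δ, hδ, h.mono fun w hw hw' => hw (hsub hw')⟩
  have hx₀ : P - R • ν ∈ Ω := hball (Metric.mem_ball_self hR)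
  have hlow := exists_low_of_chain hΩo hΩc Low hmono
    (fun z r R ρ hr hz ⟨δ, hδ, h⟩ hρ hρR hsub => by
      obtain ⟨l, hl, ε, hε, hb⟩ := hbar hr (hρ.trans hρR) hδ (Or.inl hz) h hsub
      exact hpos z l ε ρ ((ρ + R) / 2) hl hε hρ (by linarith)
        (hb ((ρ + R) / 2) (by linarith) (by linarith)).1)
    (by
      obtain ⟨x, hx, hux⟩ := hu1
      have hupos : 0 < u x := lt_of_le_of_ne (hu0 x hx) hux.symm
      have hcx : ContinuousAt u x := hucont.continuousAt (hΩo.mem_nhds hx)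
      obtain ⟨s, hs, hsb⟩ := Metric.mem_nhds_iff.1
        (inter_mem (hΩo.mem_nhds hx) (hcx.eventually (lt_mem_nhds (half_lt_self hupos))))
      have hsΩ : Metric.ball x s ⊆ Ω := fun y hy => (hsb hy).1
      -- The centre lies s/2 below the base, so the inner ball of radius s/2 misses the cylinder and
      -- its bound is vacuous. On the base inside the ball of radius s, u is bounded below by u x /
      -- 2.
      obtain ⟨l, hl, ε, hε, hb⟩ := hbar (z₀ := pt x (-(s / 2))) (half_pos hs) hs (half_pos hupos)
        (Or.inr (Eventually.of_forall fun y hy => le_of_lt (hsb (by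
          rw [Metric.mem_ball, dist_eq_norm] at hy ⊢
          exact (norm_fst_le (pt y 0 - pt x (-(s / 2)))).trans_lt hy)).2))
        (hC.mono fun z hz hzb => by
          rw [Metric.mem_ball, dist_eq_norm] at hzb
          have h1 := (abs_snd_le (z - pt x (-(s / 2)))).trans_lt hzb
          have h2 : (z - pt x (-(s / 2))).snd = z.snd + s / 2 := by
            change z.snd - -(s / 2) = _
            ring
          rw [h2] at h1
          linarith [(abs_lt.1 h1).2, hz.2])
        (hslab hsΩ)
      -- The point (x, s/8) is at distance 5s/8 from the centre, and 5s/8 + s/16 = 11s/16 < 3s/4 <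
      -- s.
      have hL := hpos _ l ε (11 * s / 16) (3 * s / 4) hl hε (by linarith) (by linarith)
        (hb (3 * s / 4) (by linarith) (by linarith)).1
      refine ⟨pt x (s / 8), ⟨hx, by simp; linarith⟩, s / 16, by linarith, hmono _ _ _ _ hL
        (Metric.ball_subset_ball' ?_)⟩
      rw [(isometry_pt_right x).dist_eq, Real.dist_eq, abs_of_pos (by linarith)]
      linarith) hx₀
  obtain ⟨r, hr, δ, hδ, hlow⟩ := hlow
  obtain ⟨l, hl, ε, hε, hb⟩ := hbar (z₀ := pt (P - R • ν) 0) hr hR hδ (Or.inl le_rfl) hlow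
    (hslab hball)
  have hdist : ∀ t : ℝ, -R ≤ t → ‖P + t • ν - (P - R • ν)‖ = R + t := fun t ht => by
    rw [show P + t • ν - (P - R • ν) = (R + t) • ν by rw [add_smul]; abel, norm_smul, hν1,
      Real.norm_of_nonneg (by linarith), mul_one]
  refine hu.normalDeriv_neg (Metric.isOpen_ball (x := P - R • ν) (ε := R)) (convex_ball _ _) hball
    hl hε hR (fun t ht => ?_) huP fun t ht => ?_
  · rw [closure_ball _ hR.ne', Metric.mem_closedBall, dist_eq_norm, hdist t ht.1]
    linarith [ht.2]
  · refine exp_bound_of_lt (by linarith [ht.2]) fun ρ h1 h2 => ?_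
    have hd := hdist t ht.1.le
    have hsub : Metric.ball (P - R • ν) ρ ⊆ Ω := (Metric.ball_subset_ball h2.le).trans hball
    have hae : ∀ᵐ x ∂(volume.restrict (Metric.ball (P - R • ν) ρ)),
        ε * (Real.exp (-l * ‖x - (P - R • ν)‖ ^ 2) - Real.exp (-l * ρ ^ 2)) ≤ u x := by
      filter_upwards [ae_restrict_of_ae_restrict_of_subset hsub (hb ρ (by linarith [ht.1]) h2).2,
        ae_restrict_mem Metric.isOpen_ball.measurableSet] with x hx hxb
      rw [Metric.mem_ball, dist_eq_norm] at hxb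
      have := hx (by rwa [pt_sub, sub_zero, norm_pt_zero])
      rwa [barrier_pt_zero] at this
    -- The comparison holds for a.e. x only, and the normal segment is a null set when n > 1;
    -- continuity of u gives the bound on the segment.
    have := le_of_ae_le_of_continuousOn Metric.isOpen_ball (Continuous.continuousOn (by fun_prop))
      (hucont.mono hsub) hae (x := P + t • ν) (by
        rw [Metric.mem_ball, dist_eq_norm, hd]; exact h1)
    rwa [hd] at this

end HalfCyl

/-! ### The theorem -/

theorem mainTheorem12 (n : ℕ) (Ω : Set (EuclideanSpace ℝ (Fin n)))
    (hΩo : IsOpen Ω) (hΩc : IsConnected Ω) (hΩb : Bornology.IsBounded Ω)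
    (c : EuclideanSpace ℝ (Fin n) → ℝ) (hc : MemLp c ⊤ (volume.restrict Ω)) :
    -- (i)
    (HalfCyl.SmoothBoundary Ω →
      ∀ u Au : EuclideanSpace ℝ (Fin n) → ℝ,
        HalfCyl.IsC2Closure Ω u →
        (∃ x ∈ Ω, u x ≠ 0) →
        HalfCyl.IsSqrtDirichletLaplacian Ω u Au →
        (∀ᵐ x ∂(volume.restrict Ω), 0 ≤ Au x + c x * u x) →
        (∀ x ∈ Ω, 0 ≤ u x) →
        (∀ x ∈ frontier Ω, u x = 0) →
        ∀ P ∈ frontier Ω, ∀ ν₀, HalfCyl.IsUnitOuterNormal Ω P ν₀ →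
          HalfCyl.normalDeriv u P ν₀ < 0) ∧
    -- (ii)
    (∀ P ∈ frontier Ω, HalfCyl.SmoothBoundaryAt Ω P →
      ∀ v : HalfCyl.Space n → ℝ,
        HalfCyl.IsC2Closure (HalfCyl.cylinder Ω) v →
        (∃ M : ℝ, ∀ z ∈ HalfCyl.cylinder Ω, |v z| ≤ M) →
        (∃ z ∈ HalfCyl.cylinder Ω, v z ≠ 0) →
        InnerProductSpace.HarmonicOnNhd v (HalfCyl.cylinder Ω) →
        (∀ x ∈ frontier Ω, ∀ y : ℝ, 0 ≤ y → 0 ≤ v (HalfCyl.pt x y)) →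
        (∀ x ∈ Ω, 0 ≤ v (HalfCyl.pt x 0)) →
        (∀ᵐ x ∂(volume.restrict Ω),
          0 ≤ HalfCyl.normalDeriv v (HalfCyl.pt x 0) (HalfCyl.pt 0 (-1))
            + c x * v (HalfCyl.pt x 0)) →
        v (HalfCyl.pt P 0) = 0 →
        ∀ ν₀, HalfCyl.IsUnitOuterNormal Ω P ν₀ →
          HalfCyl.normalDeriv v (HalfCyl.pt P 0) (HalfCyl.pt ν₀ 0) < 0) := by
  refine ⟨fun _ u Au hu hu1 hAu hineq hu0 hub P hP ν₀ hν => ?_,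
    fun P hP _ v hv ⟨B, hB⟩ hv1 hharm hlat hbase hneu hvP ν₀ hν => ?_⟩
  · exact HalfCyl.normalDeriv_neg_of_sqrtDirichletLaplacian hΩo hΩc.isPreconnected hΩb hc hu hu1
      hAu hineq hu0 hP (hub P hP) hν
  · exact HalfCyl.normalDeriv_neg_of_harmonic hΩo hΩc.isPreconnected hΩb hc hP hν hv hB hv1 hharm
      hlat hbase hneu hvP
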